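/- **Setting.** Consider a finite discounted MDP with state space $\mathcal S$, $|\mathcal S|=S$, action space $\mathcal A$, $|\mathcal A|=A$, transition probabilities $p(s'\mid s,a)$, deterministic rewards $r:\mathcal S\times\mathcal A\to[0,1]$ and discount factor $\gamma$. The agent starts in a state $s_1$; at each time $t=1,2,\dots$ it observes $s_t$, takes an action $a_t$, receives $r(s_t,a_t)$ and moves to $s_{t+1}\sim p(\cdot\mid s_t,a_t)$ (there is no generative model). For a (possibly non-stationary and history-dependent) policy $\pi$ let $V^{\pi}(s)=\mathbb E\big[\sum_{i\ge1}\gamma^{i-1}r(s_i,a_i)\,\big|\,s_1=s\big]$, the actions being chosen by $\pi$, and let $V^*(s)=\sup_\pi V^\pi(s)$. For an algorithm, let $\pi_t$ be the non-stationary policy that it follows from time $t$ on, given the history up to time $t$. The *sample complexity of exploration* of the algorithm is the number of times $t$ with $V^{\pi_t}(s_t)<V^*(s_t)-\epsilon$. **Algorithm (Infinite Q-learning with UCB), with parameters $\epsilon,\delta,\gamma$.** Put $$R=\Big\lceil \tfrac{1}{1-\gamma}\ln\tfrac{3}{\epsilon(1-\gamma)}\Big\rceil,\quad L=\lfloor\log_2R\rfloor,\quad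 \xi_L=\frac{\epsilon/3}{2^{L+2}\ln\frac1{1-\gamma}},\quad M=\max\Big\{\Big\lceil2\log_2\tfrac1{\xi_L(1-\gamma)}\Big\rceil,10\Big\},$$ $$\epsilon_1=\frac{\epsilon}{24RM\ln\frac1{1-\gamma}},\quad H=\frac{\ln\frac{1}{(1-\gamma)\epsilon_1}}{\ln\frac1\gamma},\quad \iota(k)=\ln\frac{SA(k+1)(k+2)}{\delta},\quad \alpha_k=\frac{H+1}{H+k},\quad b_k=\frac{4\sqrt2}{1-\gamma}\sqrt{\frac{H\iota(k)}{k}}.$$ (For $\epsilon\ge\frac1{1-\gamma}$, where some of these may be undefined, no step is ever counted, so their values are immaterial.) Initialize $Q(s,a)=\hat Q(s,a)=\frac1{1-\gamma}$ and $N(s,a)=0$ for all $(s,a)$. At each time $t=1,2,\dots$: take an action $a_t\in\arg\max_{a}\hat Q(s_t,a)$ (ties broken by any deterministic rule, which may depend on the history), observe $r(s_t,a_t)$ and $s_{t+1}$, then set in this order $N(s_t,a_t)\leftarrow N(s_t,a_t)+1$, $k\leftarrow N(s_t,a_t)$, $\hat V\leftarrow\max_a\hat Q(s_{t+1},a)$,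 $Q(s_t,a_t)\leftarrow(1-\alpha_k)Q(s_t,a_t)+\alpha_k\big[r(s_t,a_t)+b_k+\gamma\hat V\big]$, and $\hat Q(s_t,a_t)\leftarrow\min\{\hat Q(s_t,a_t),Q(s_t,a_t)\}$. **Theorem.** There are absolute constants $C>0$ and $k\in\mathbb N$ such that, for every finite MDP as above, every initial state $s_1$, and all $\epsilon>0$, $\delta>0$ and $1/2<\gamma<1$, with probability at least $1-\delta$ the sample complexity of exploration of this algorithm is at most $$C\,\Big(1+\ln(SA)+\max\{0,\ln\tfrac1\epsilon\}+\ln\tfrac1{1-\gamma}\Big)^{k}\cdot\frac{SA\,\max\{1,\ln\frac1\delta\}}{\epsilon^2(1-\gamma)^7}.$$ That is, it is $\tilde O\big(SA\ln(1/\delta)/(\epsilon^2(1-\gamma)^7)\big)$, where $\tilde O$ suppresses logarithmic factors of $1/\epsilon$, $1/(1-\gamma)$ and $SA$. -/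

import Mathlib

open MeasureTheory ProbabilityTheory
open scoped ENNReal

noncomputable section

namespace UCBQ

/-- A finite Markov decision process without its discount factor: transition probabilities
`P s a` and a deterministic reward function with values in `[0, 1]`. -/
structure MDP (S A : Type*) where
  P : S → A → PMF S
  r : S → A → ℝ
  r_mem : ∀ s a, r s a ∈ Set.Icc (0 : ℝ) 1

/-- A (non-stationary, history-dependent) policy: `π h s` is the action taken in the current
state `s` when the earlier states, in chronological order, are `h`.  Rewards are deterministic
and actions are chosen deterministically, so the past states determine the whole past. -/
abbrev Policy (S A : Type*) := List S → S → A

/-- The states visited strictly before time `t` along `ω` (time starts at `0`). -/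
def past {S : Type*} (ω : ℕ → S) (t : ℕ) : List S := List.ofFn fun i : Fin t => ω i

/-- The action taken by `π` at time `t` along the state trajectory `ω`. -/
def act {S A : Type*} (π : Policy S A) (ω : ℕ → S) (t : ℕ) : A := π (past ω t) (ω t)

/-- The policy that `π` follows from now on, once the states `h` have been visited. -/
def after {S A : Type*} (π : Policy S A) (h : List S) : Policy S A := fun h' s => π (h ++ h') s

section Law

variable {S A : Type*} [Fintype S] [MeasurableSpace S] [MeasurableSingletonClass S]

/-- Conditional law of the state at time `n + 1`, given the states at the times `0, …, n`, when
the actions are chosen by `π`. -/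
def stepKernel (M : MDP S A) (π : Policy S A) (n : ℕ) :
    Kernel ((_ : Finset.Iic n) → S) S :=
  Kernel.ofFunOfCountable fun x =>
    (M.P (x ⟨n, Finset.mem_Iic.2 le_rfl⟩)
      (π (List.ofFn fun i : Fin n => x ⟨i, Finset.mem_Iic.2 i.isLt.le⟩)
        (x ⟨n, Finset.mem_Iic.2 le_rfl⟩))).toMeasure

instance (M : MDP S A) (π : Policy S A) (n : ℕ) : IsMarkovKernel (stepKernel M π n) :=
  ⟨fun _ => PMF.toMeasure.isProbabilityMeasure _⟩

/-- The law of the state trajectory started at `s` under the policy `π`. -/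
def trajLaw (M : MDP S A) (π : Policy S A) (s : S) : Measure (ℕ → S) :=
  Kernel.traj (X := fun _ : ℕ => S) (stepKernel M π) 0 (fun _ => s)

/-- The value `V^π(s)`: expected discounted total reward. -/
def value (M : MDP S A) (γ : ℝ) (π : Policy S A) (s : S) : ℝ :=
  ∫ ω, ∑' i : ℕ, γ ^ i * M.r (ω i) (act π ω i) ∂(trajLaw M π s)

/-- The optimal value `V^*(s) = sup_π V^π(s)`. -/
def optValue (M : MDP S A) (γ : ℝ) (s : S) : ℝ := ⨆ π : Policy S A, value M γ π s

/-- Sample complexity of exploration of the algorithm that acts by `π`, along the trajectory `ω`: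
the number of times `t` such that the policy followed by the algorithm from time `t` on is not
`ε`-optimal at the current state. -/
def sampleComplexity (M : MDP S A) (γ ε : ℝ) (π : Policy S A) (ω : ℕ → S) : ℕ∞ :=
  Set.encard {t : ℕ | value M γ (after π (past ω t)) (ω t) < optValue M γ (ω t) - ε}

end Law

section Parameters

/-- `R = ⌈ln(3 / (ε (1 - γ))) / (1 - γ)⌉`. -/
def paramR (ε γ : ℝ) : ℕ := ⌈Real.log (3 / (ε * (1 - γ))) / (1 - γ)⌉₊

/-- `ξ i = 2^{-(i+2)} (ε / 3) / ln(1 / (1 - γ))`. -/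
def paramXi (ε γ : ℝ) (i : ℕ) : ℝ := 1 / 2 ^ (i + 2) * (ε / 3) * (Real.log (1 / (1 - γ)))⁻¹

/-- `M = max {⌈2 log₂ (1 / (ξ_L (1 - γ)))⌉, 10}` with `L = ⌊log₂ R⌋`. -/
def paramM (ε γ : ℝ) : ℕ :=
  max ⌈2 * Real.logb 2 (1 / (paramXi ε γ (Nat.log 2 (paramR ε γ)) * (1 - γ)))⌉₊ 10

/-- `ε₁ = ε / (24 R M ln(1 / (1 - γ)))`. -/
def paramEps1 (ε γ : ℝ) : ℝ :=
  ε / (24 * paramR ε γ * paramM ε γ * Real.log (1 / (1 - γ)))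

/-- `H = ln(1 / ((1 - γ) ε₁)) / ln(1 / γ)`. -/
def paramH (ε γ : ℝ) : ℝ :=
  Real.log (1 / ((1 - γ) * paramEps1 ε γ)) / Real.log (1 / γ)

/-- `ι(k) = ln(S A (k+1) (k+2) / δ)`, where `m = S A`. -/
def iota (m : ℕ) (δ : ℝ) (k : ℕ) : ℝ := Real.log (m * (k + 1) * (k + 2) / δ)

/-- The learning rate `α_k = (H + 1) / (H + k)`. -/
def alpha (ε γ : ℝ) (k : ℕ) : ℝ := (paramH ε γ + 1) / (paramH ε γ + k)

/-- The bonus `b_k = c₂ / (1 - γ) * √(H ι(k) / k)` with `c₂ = 4 √2`. -/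
def bonus (m : ℕ) (ε δ γ : ℝ) (k : ℕ) : ℝ :=
  4 * √2 / (1 - γ) * √(paramH ε γ * iota m δ k / k)

end Parameters

section Algorithm

/-- The memory of the algorithm: the tables `Q`, `Q̂` and the visit counts `N`. -/
structure Memory (S A : Type*) where
  Q : S → A → ℝ
  Qhat : S → A → ℝ
  N : S → A → ℕ

/-- Initial memory. -/
def initMemory (S A : Type*) (γ : ℝ) : Memory S A where
  Q := fun _ _ => 1 / (1 - γ)
  Qhat := fun _ _ => 1 / (1 - γ)
  N := fun _ _ => 0

variable {S A : Type*} [Fintype S] [Fintype A] [DecidableEq S] [DecidableEq A]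

/-- One pass through the loop of the algorithm, in which action `a` is taken in state `s`, the
reward `ρ` is received and the next state is `s'`; the value of `s'` is computed with `Q̂` as it
is before the update. -/
def Memory.update (m : Memory S A) (ε δ γ : ℝ) (s : S) (a : A) (ρ : ℝ) (s' : S) :
    Memory S A :=
  let k : ℕ := m.N s a + 1
  let q : ℝ := (1 - alpha ε γ k) * m.Q s a + alpha ε γ k *
    (ρ + bonus (Fintype.card S * Fintype.card A) ε δ γ k + γ * ⨆ a' : A, m.Qhat s' a')
  { Q := fun x y => if x = s ∧ y = a then q else m.Q x y
    Qhat := fun x y => if x = s ∧ y = a then min (m.Qhat s a) q else m.Qhat x y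
    N := fun x y => if x = s ∧ y = a then k else m.N x y }

/-- The memory on arrival at the state `ω t`, when the actions so far were those of `π`. -/
def memory (M : MDP S A) (ε δ γ : ℝ) (π : Policy S A) (ω : ℕ → S) : ℕ → Memory S A
  | 0 => initMemory S A γ
  | t + 1 => (memory M ε δ γ π ω t).update ε δ γ (ω t) (act π ω t)
      (M.r (ω t) (act π ω t)) (ω (t + 1))

/-- `π` is an execution of Infinite Q-learning with UCB with parameters `ε, δ, γ`: at each time it
takes an action that maximizes `Q̂(s_t, ·)`; ties may be broken in any way. -/
def IsUCBQLearning (M : MDP S A) (ε δ γ : ℝ) (π : Policy S A) : Prop :=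
  ∀ (ω : ℕ → S) (t : ℕ) (a : A),
    (memory M ε δ γ π ω t).Qhat (ω t) a ≤ (memory M ε δ γ π ω t).Qhat (ω t) (act π ω t)

end Algorithm

end UCBQ

end

/-!
Write `Δ_t = V^*(s_t) - Q^*(s_t, a_t)` for the gap of the action taken at time `t`, and `G_t` for
the loss `V^*(s_t) - V^{π_t}(s_t)` of the policy followed from time `t` on, so that
`G_t = Δ_t + γ E[G_{t+1} | s_0, …, s_t]`.  Let `B` be the set of times with `G_t > ε`.  Unrolling
this identity from every time of `B` shows that `∑_{t ∈ B} G_t` is `∑_u w_u Δ_u`, plus a martingale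
with increments of size `w_u / (1 - γ)`, plus a bounded remainder, where
`w_u = ∑_{t ∈ B, t ≤ u} γ^{u-t}` is at most `1 / (1 - γ)` and sums to at most `|B| / (1 - γ)`
(`mul_sum_badTime_le`).  By Azuma–Hoeffding the martingale is at most `ε |B| / 4` up to a term
`O(ln (1/δ) / (ε (1 - γ)^4))` (`measure_lossDeviation_le`).

The weighted sum of the gaps is controlled on an event of large probability on which, for every
state-action pair and every number of visits, the sampling errors averaged by the learning rates are
below the bonuses (`WellSampled`, `measure_not_wellSampled_le`).  On this event the tables are
optimistic (`optQ_le_Qhat`), and `φ_t = Q̂_t(s_t, a_t) - Q^*(s_t, a_t)`, which dominates `Δ_t`, is at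
most three bonuses plus `γ` times the average of the value errors at the successors of the earlier
visits (`Qhat_sub_optQ_le`).  Those errors are themselves errors `φ` at later times, up to the
decrease of `Q̂` in one update, which telescopes.  A weighted sum of the `φ_t` with weights at most
`W` and total `C` is hence bounded by a direct term plus `γ` times such a sum with weights at most
`(1 + 1/H) W` and total at most `C`.  Since `γ (1 + 1/H) ≤ (1 + γ) / 2`, iterating this costs only a
factor `O(1 / (1 - γ))` (`sum_weighted_error_le`).

With `W = 1 / (1 - γ)`, `C = |B| / (1 - γ)` and bonuses of order `√(H ln(·) / n) / (1 - γ)`, this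
gives `ε |B| ≲ √(S A |B| / (1 - γ)^7)`, which is the claim.  Instead of square roots of `|B|`, the
proofs carry linear bounds with a threshold `θ` for `1 / √n`, chosen at the end.  All estimates are
made at a fixed time horizon `T` and are uniform in `T`; as the number of bad times before `T`
increases with `T`, the limit is continuity of the measure from above.
-/

namespace UCBQ

/-! ### Trajectories and their prefixes -/

section Paths

variable {S A : Type*}

/-- The continuation of a finite trajectory that stays in its last state. -/
def extendPath (t : ℕ) (x : (_ : Finset.Iic t) → S) : ℕ → S := fun n =>
  if h : n ≤ t then x ⟨n, Finset.mem_Iic.2 h⟩ else x ⟨t, Finset.mem_Iic.2 le_rfl⟩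

lemma extendPath_restrict (t : ℕ) (ω : ℕ → S) {i : ℕ} (hi : i ≤ t) :
    extendPath t (Preorder.frestrictLe (π := fun _ : ℕ => S) t ω) i = ω i := by
  simp [extendPath, hi]

lemma past_congr {t : ℕ} {ω ω' : ℕ → S} (h : ∀ i < t, ω i = ω' i) : past ω t = past ω' t := by
  unfold past
  congr 1
  funext i
  exact h i i.isLt

lemma past_succ (ω : ℕ → S) (t : ℕ) : past ω (t + 1) = past ω t ++ [ω t] := by
  unfold past
  rw [List.ofFn_succ']
  simp [List.concat_eq_append]

lemma act_congr (π : Policy S A) {t : ℕ} {ω ω' : ℕ → S} (h : ∀ i ≤ t, ω i = ω' i) :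
    act π ω t = act π ω' t := by
  unfold act
  rw [past_congr fun i hi => h i hi.le, h t le_rfl]

end Paths

/-! ### The law of the trajectory -/

section TrajectoryLaw

variable {S A : Type*} [Fintype S] [MeasurableSpace S] [MeasurableSingletonClass S]

instance (M : MDP S A) (π : Policy S A) (s : S) : IsProbabilityMeasure (trajLaw M π s) := by
  unfold trajLaw; infer_instance

lemma measurable_of_agree {E : Type*} [MeasurableSpace E] (t : ℕ) (F : (ℕ → S) → E)
    (hF : ∀ ω ω' : ℕ → S, (∀ i ≤ t, ω i = ω' i) → F ω = F ω') : Measurable F := by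
  have : F = (fun x => F (extendPath t x)) ∘ Preorder.frestrictLe (π := fun _ : ℕ => S) t := by
    funext ω
    exact hF _ _ fun i hi => (extendPath_restrict t ω hi).symm
  rw [this]
  exact (measurable_of_countable _).comp (Preorder.measurable_frestrictLe t)

lemma integrable_of_agree (M : MDP S A) (π : Policy S A) (s : S) (t : ℕ) (F : (ℕ → S) → ℝ)
    (hF : ∀ ω ω' : ℕ → S, (∀ i ≤ t, ω i = ω' i) → F ω = F ω') :
    Integrable F (trajLaw M π s) := by
  have hb : ∀ ω, ‖F ω‖ ≤ ∑ x : ((_ : Finset.Iic t) → S), ‖F (extendPath t x)‖ := by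
    intro ω
    rw [hF ω (extendPath t (Preorder.frestrictLe (π := fun _ : ℕ => S) t ω))
      fun i hi => (extendPath_restrict t ω hi).symm]
    exact Finset.single_le_sum (f := fun x => ‖F (extendPath t x)‖)
      (fun _ _ => norm_nonneg _) (Finset.mem_univ _)
  exact Integrable.of_bound (measurable_of_agree t F hF).aestronglyMeasurable _
    (Filter.Eventually.of_forall hb)

/-- The trajectory starts at the prescribed state. -/
lemma ae_start (M : MDP S A) (π : Policy S A) (s : S) : ∀ᵐ ω ∂(trajLaw M π s), ω 0 = s := by
  have h := Kernel.traj_map_frestrictLe_apply (X := fun _ : ℕ => S) (κ := stepKernel M π) 0 0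
    (fun _ => s)
  rw [Kernel.partialTraj_self, Kernel.id_apply] at h
  have h2 : ∀ᵐ x ∂((trajLaw M π s).map (Preorder.frestrictLe (π := fun _ : ℕ => S) 0)),
      x = fun _ => s := by
    unfold trajLaw
    rw [h]
    exact (ae_dirac_iff (measurableSet_singleton _)).2 rfl
  have h3 := ae_of_ae_map (Preorder.measurable_frestrictLe 0).aemeasurable h2
  filter_upwards [h3] with ω hω
  exact congrFun hω ⟨0, Finset.mem_Iic.2 le_rfl⟩

/-- One step of the Markov decision process: given the states up to time `t`, the next state is
drawn from the transition probabilities of the current state and action. -/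
lemma integral_step (M : MDP S A) (π : Policy S A) (s : S) (t : ℕ) (F : (ℕ → S) → S → ℝ)
    (hF : ∀ ω ω' : ℕ → S, (∀ i ≤ t, ω i = ω' i) → F ω = F ω') :
    ∫ ω, F ω (ω (t + 1)) ∂(trajLaw M π s) =
      ∫ ω, ∑ s', (M.P (ω t) (act π ω t) s').toReal * F ω s' ∂(trajLaw M π s) := by
  set G : ((_ : Finset.Iic t) → S) → (ℕ → S) → ℝ := fun x ω => F (extendPath t x) (ω (t + 1))
    with hG
  have hGm : Measurable G.uncurry := by
    have : G.uncurry = (fun p : ((_ : Finset.Iic t) → S) × S => F (extendPath t p.1) p.2) ∘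
        (fun p : ((_ : Finset.Iic t) → S) × (ℕ → S) => (p.1, p.2 (t + 1))) := rfl
    rw [this]
    exact (measurable_of_countable _).comp (by fun_prop)
  have hGb : ∀ p, ‖G.uncurry p‖ ≤
      ∑ q : ((_ : Finset.Iic t) → S) × S, ‖F (extendPath t q.1) q.2‖ := fun p =>
    Finset.single_le_sum (f := fun q : ((_ : Finset.Iic t) → S) × S =>
        ‖F (extendPath t q.1) q.2‖)
      (fun _ _ => norm_nonneg _) (Finset.mem_univ (p.1, p.2 (t + 1)))
  have key := Kernel.integral_traj_partialTraj' (X := fun _ : ℕ => S) (κ := stepKernel M π)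
    (Nat.zero_le t) (x₀ := fun _ => s) (f := G)
    (Integrable.of_bound hGm.aestronglyMeasurable _ (Filter.Eventually.of_forall hGb))
  have e1 : ∫ ω, F ω (ω (t + 1)) ∂(trajLaw M π s) =
      ∫ ω, G (Preorder.frestrictLe t ω) ω ∂(trajLaw M π s) := by
    congr 1
    funext ω
    rw [hG]
    dsimp only
    rw [hF ω _ fun i hi => (extendPath_restrict t ω hi).symm]
  have hin : ∀ x : ((_ : Finset.Iic t) → S),
      ∫ y, G x y ∂(Kernel.traj (X := fun _ : ℕ => S) (stepKernel M π) t x) =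
      ∑ s', (M.P (x ⟨t, Finset.mem_Iic.2 le_rfl⟩)
        (act π (extendPath t x) t) s').toReal * F (extendPath t x) s' := by
    intro x
    have h1 := Kernel.map_traj_succ_self (X := fun _ : ℕ => S) (κ := stepKernel M π) (a := t)
    have h2 : (Kernel.traj (X := fun _ : ℕ => S) (stepKernel M π) t x).map
        (fun y => y (t + 1)) = stepKernel M π t x := by
      rw [← Kernel.map_apply _ (by fun_prop), h1]
    have h3 : ∫ y, G x y ∂(Kernel.traj (X := fun _ : ℕ => S) (stepKernel M π) t x) =
        ∫ s', F (extendPath t x) s' ∂(stepKernel M π t x) := by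
      rw [← h2, integral_map (measurable_pi_apply (t + 1)).aemeasurable (measurable_of_countable _).aestronglyMeasurable]
    have h4 : stepKernel M π t x = (M.P (x ⟨t, Finset.mem_Iic.2 le_rfl⟩)
        (act π (extendPath t x) t)).toMeasure := by
      unfold stepKernel act past
      change PMF.toMeasure _ = _
      congr 1
      have : extendPath t x t = x ⟨t, Finset.mem_Iic.2 le_rfl⟩ := by simp [extendPath]
      rw [this]
      congr 2
      refine congrArg List.ofFn (funext fun i => ?_)
      simp [extendPath, i.isLt.le]
    rw [h3, h4, PMF.integral_eq_sum]
    rfl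
  rw [e1]
  unfold trajLaw
  rw [← key]
  simp_rw [hin]
  rw [← Kernel.traj_map_frestrictLe_apply, integral_map
    (Preorder.measurable_frestrictLe t).aemeasurable
    (measurable_of_countable _).aestronglyMeasurable]
  congr 1
  funext ω
  rw [act_congr π (t := t) (ω := extendPath t (Preorder.frestrictLe t ω)) (ω' := ω)
    fun i hi => extendPath_restrict t ω hi,
    hF ω _ fun i hi => (extendPath_restrict t ω hi).symm]
  rfl

end TrajectoryLaw

/-! ### Expectations over the next state -/

section ExpectedNext

variable {S A : Type*} [Fintype S]

/-- Expectation of `f` at the state that follows `s` when the action `a` is taken. -/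
noncomputable def MDP.next (M : MDP S A) (s : S) (a : A) (f : S → ℝ) : ℝ :=
  ∑ s', (M.P s a s').toReal * f s'

lemma MDP.sum_toReal (M : MDP S A) (s : S) (a : A) : ∑ s', (M.P s a s').toReal = 1 := by
  have h := (M.P s a).tsum_coe
  rw [tsum_fintype] at h
  rw [← ENNReal.toReal_sum (fun s' _ => (M.P s a).apply_ne_top s'), h, ENNReal.toReal_one]

lemma MDP.next_mono (M : MDP S A) (s : S) (a : A) {f g : S → ℝ} (h : ∀ x, f x ≤ g x) :
    M.next s a f ≤ M.next s a g :=
  Finset.sum_le_sum fun x _ => mul_le_mul_of_nonneg_left (h x) ENNReal.toReal_nonneg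

lemma MDP.next_const (M : MDP S A) (s : S) (a : A) (c : ℝ) : M.next s a (fun _ => c) = c := by
  unfold MDP.next
  rw [← Finset.sum_mul, M.sum_toReal, one_mul]

lemma MDP.next_add (M : MDP S A) (s : S) (a : A) (f g : S → ℝ) :
    M.next s a (fun x => f x + g x) = M.next s a f + M.next s a g := by
  simp [MDP.next, mul_add, Finset.sum_add_distrib]

lemma MDP.next_sub (M : MDP S A) (s : S) (a : A) (f g : S → ℝ) :
    M.next s a (fun x => f x - g x) = M.next s a f - M.next s a g := by
  simp [MDP.next, mul_sub, Finset.sum_sub_distrib]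

lemma MDP.next_mul (M : MDP S A) (s : S) (a : A) (c : ℝ) (f : S → ℝ) :
    M.next s a (fun x => c * f x) = c * M.next s a f := by
  simp only [MDP.next, Finset.mul_sum]
  exact Finset.sum_congr rfl fun x _ => by ring

lemma MDP.next_nonneg (M : MDP S A) (s : S) (a : A) {f : S → ℝ} (h : ∀ x, 0 ≤ f x) :
    0 ≤ M.next s a f :=
  Finset.sum_nonneg fun x _ => mul_nonneg ENNReal.toReal_nonneg (h x)

/-- Hoeffding's lemma for the next state. -/
lemma MDP.next_exp_le_one (M : MDP S A) (s : S) (a : A) {f : S → ℝ} {B : ℝ}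
    (hf : ∀ x, f x ∈ Set.Icc 0 B) (lam : ℝ) :
    M.next s a (fun x => Real.exp (lam * (M.next s a f - f x) - lam ^ 2 * B ^ 2 / 8)) ≤ 1 := by
  let _ : MeasurableSpace S := ⊤
  have : MeasurableSingletonClass S := ⟨fun _ => trivial⟩
  have h := hasSubgaussianMGF_of_mem_Icc (μ := (M.P s a).toMeasure) (X := f)
    (measurable_of_countable f).aemeasurable (Filter.Eventually.of_forall hf)
  have h1 := h.mgf_le (-lam)
  unfold mgf at h1
  rw [PMF.integral_eq_sum, PMF.integral_eq_sum] at h1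
  simp only [smul_eq_mul] at h1
  have e1 : M.next s a f = ∑ x, (M.P s a x).toReal * f x := rfl
  have e2 : M.next s a
      (fun x => Real.exp (lam * (M.next s a f - f x) - lam ^ 2 * B ^ 2 / 8)) =
      Real.exp (-(lam ^ 2 * B ^ 2 / 8)) *
        M.next s a (fun x => Real.exp (-lam * (f x - M.next s a f))) := by
    rw [← M.next_mul]
    congr 1
    funext x
    rw [← Real.exp_add]
    congr 1
    ring
  rw [e2]
  have h2 : M.next s a (fun x => Real.exp (-lam * (f x - M.next s a f))) ≤
      Real.exp (lam ^ 2 * B ^ 2 / 8) := by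
    refine h1.trans (le_of_eq ?_)
    congr 1
    simp only [sub_zero, NNReal.coe_pow, NNReal.coe_div, coe_nnnorm, NNReal.coe_ofNat,
      Real.norm_eq_abs, div_pow, sq_abs]
    ring
  calc _ ≤ Real.exp (-(lam ^ 2 * B ^ 2 / 8)) * Real.exp (lam ^ 2 * B ^ 2 / 8) :=
        mul_le_mul_of_nonneg_left h2 (Real.exp_nonneg _)
    _ = 1 := by rw [← Real.exp_add]; simp

end ExpectedNext

/-! ### Concentration of adapted sums -/

section Concentration

variable {S A : Type*} [Fintype S] [MeasurableSpace S] [MeasurableSingletonClass S]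

lemma integral_exp_sum_le_one (M : MDP S A) (π : Policy S A) (s : S)
    (D : ℕ → (ℕ → S) → S → ℝ)
    (hD : ∀ t, ∀ ω ω' : ℕ → S, (∀ i ≤ t, ω i = ω' i) → D t ω = D t ω')
    (hstep : ∀ t ω, M.next (ω t) (act π ω t) (fun x => Real.exp (D t ω x)) ≤ 1) (T : ℕ) :
    ∫ ω, Real.exp (∑ t ∈ Finset.range T, D t ω (ω (t + 1))) ∂(trajLaw M π s) ≤ 1 := by
  have hsum : ∀ T, ∀ ω ω' : ℕ → S, (∀ i ≤ T, ω i = ω' i) →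
      ∑ t ∈ Finset.range T, D t ω (ω (t + 1)) = ∑ t ∈ Finset.range T, D t ω' (ω' (t + 1)) := by
    intro T ω ω' h
    refine Finset.sum_congr rfl fun t ht => ?_
    have ht := Finset.mem_range.1 ht
    rw [hD t ω ω' fun i hi => h i (hi.trans ht.le), h (t + 1) ht]
  induction T with
  | zero => simp
  | succ T ih =>
    refine le_trans ?_ ih
    have h := integral_step M π s T
      (fun ω x => Real.exp (∑ t ∈ Finset.range T, D t ω (ω (t + 1))) * Real.exp (D T ω x))
      (fun ω ω' h => by rw [hsum T ω ω' h, hD T ω ω' h])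
    have e : ∀ ω : ℕ → S, Real.exp (∑ t ∈ Finset.range (T + 1), D t ω (ω (t + 1))) =
        Real.exp (∑ t ∈ Finset.range T, D t ω (ω (t + 1))) * Real.exp (D T ω (ω (T + 1))) := by
      intro ω
      rw [Finset.sum_range_succ, Real.exp_add]
    simp_rw [e]
    rw [h]
    refine integral_mono (integrable_of_agree M π s T _ fun ω ω' h => ?_)
      (integrable_of_agree M π s T _ fun ω ω' h => by rw [hsum T ω ω' h]) fun ω => ?_
    · rw [hsum T ω ω' h, hD T ω ω' h, act_congr π h, h T le_rfl]
    · have := mul_le_mul_of_nonneg_left (hstep T ω)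
        (Real.exp_nonneg (∑ t ∈ Finset.range T, D t ω (ω (t + 1))))
      rw [← M.next_mul, mul_one] at this
      exact this

/-- An Azuma–Hoeffding bound in exponential form, for weights that may depend on the past. -/
lemma measure_weighted_deviation_le (M : MDP S A) (π : Policy S A) (s : S)
    (w : ℕ → (ℕ → S) → ℝ) (g : ℕ → (ℕ → S) → S → ℝ) (B : ℝ)
    (hw : ∀ t, ∀ ω ω' : ℕ → S, (∀ i ≤ t, ω i = ω' i) → w t ω = w t ω')
    (hg : ∀ t, ∀ ω ω' : ℕ → S, (∀ i ≤ t, ω i = ω' i) → g t ω = g t ω')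
    (hgB : ∀ t ω x, g t ω x ∈ Set.Icc 0 B) (lam L : ℝ) (T : ℕ) :
    trajLaw M π s {ω | L ≤ lam * ∑ t ∈ Finset.range T,
        w t ω * (M.next (ω t) (act π ω t) (g t ω) - g t ω (ω (t + 1))) -
        lam ^ 2 * B ^ 2 / 8 * ∑ t ∈ Finset.range T, w t ω ^ 2} ≤
      ENNReal.ofReal (Real.exp (-L)) := by
  set D : ℕ → (ℕ → S) → S → ℝ := fun t ω x =>
    (lam * w t ω) * (M.next (ω t) (act π ω t) (g t ω) - g t ω x) -
      (lam * w t ω) ^ 2 * B ^ 2 / 8 with hDdef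
  have hD : ∀ t, ∀ ω ω' : ℕ → S, (∀ i ≤ t, ω i = ω' i) → D t ω = D t ω' := by
    intro t ω ω' h
    rw [hDdef]
    dsimp only
    rw [hw t ω ω' h, hg t ω ω' h, act_congr π h, h t le_rfl]
  have hint := integral_exp_sum_le_one M π s D hD
    (fun t ω => M.next_exp_le_one _ _ (hgB t ω) _) T
  have hI : Integrable (fun ω => Real.exp (∑ t ∈ Finset.range T, D t ω (ω (t + 1))))
      (trajLaw M π s) := by
    refine integrable_of_agree M π s T _ fun ω ω' h => ?_
    congr 1
    refine Finset.sum_congr rfl fun t ht => ?_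
    have ht := Finset.mem_range.1 ht
    rw [hD t ω ω' fun i hi => h i (hi.trans ht.le), h (t + 1) ht]
  have hm := mul_meas_ge_le_integral_of_nonneg
    (Filter.Eventually.of_forall fun ω => Real.exp_nonneg _) hI (Real.exp L)
  have hset : {ω : ℕ → S | L ≤ lam * ∑ t ∈ Finset.range T,
        w t ω * (M.next (ω t) (act π ω t) (g t ω) - g t ω (ω (t + 1))) -
        lam ^ 2 * B ^ 2 / 8 * ∑ t ∈ Finset.range T, w t ω ^ 2} =
      {ω | Real.exp L ≤ Real.exp (∑ t ∈ Finset.range T, D t ω (ω (t + 1)))} := by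
    ext ω
    simp only [Set.mem_ofPred_eq, Real.exp_le_exp, hDdef]
    rw [Finset.sum_sub_distrib, Finset.mul_sum, Finset.mul_sum]
    have e1 : ∀ t, lam * w t ω * (M.next (ω t) (act π ω t) (g t ω) - g t ω (ω (t + 1))) =
      lam * (w t ω * (M.next (ω t) (act π ω t) (g t ω) - g t ω (ω (t + 1)))) := fun t => by ring
    have e2 : ∀ t, (lam * w t ω) ^ 2 * B ^ 2 / 8 = lam ^ 2 * B ^ 2 / 8 * w t ω ^ 2 :=
      fun t => by ring
    simp_rw [e1, e2]
  rw [hset, ← ENNReal.ofReal_toReal (measure_ne_top (trajLaw M π s) _)]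
  refine ENNReal.ofReal_le_ofReal ?_
  rw [Real.exp_neg, inv_eq_one_div, le_div_iff₀ (Real.exp_pos L), mul_comm]
  exact hm.trans hint

end Concentration

/-! ### Values over a finite horizon -/

section FiniteHorizon

variable {S A : Type*} [Fintype S]

/-- Expected discounted reward of the first `n` steps, by backward recursion. -/
noncomputable def horizonValue (M : MDP S A) (γ : ℝ) : ℕ → Policy S A → S → ℝ
  | 0, _, _ => 0
  | n + 1, π, s =>
    M.r s (π [] s) + γ * M.next s (π [] s) (horizonValue M γ n (after π [s]))

lemma horizonValue_nonneg (M : MDP S A) {γ : ℝ} (h0 : 0 ≤ γ) (n : ℕ) (π : Policy S A) (s : S) :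
    0 ≤ horizonValue M γ n π s := by
  induction n generalizing π s with
  | zero => exact le_rfl
  | succ n ih =>
    exact add_nonneg (M.r_mem _ _).1 (mul_nonneg h0 (M.next_nonneg _ _ fun x => ih _ x))

lemma horizonValue_le (M : MDP S A) {γ : ℝ} (h0 : 0 ≤ γ) {V : S → ℝ}
    (hV0 : ∀ s, 0 ≤ V s) (hV : ∀ s a, M.r s a + γ * M.next s a V ≤ V s)
    (n : ℕ) (π : Policy S A) (s : S) :
    horizonValue M γ n π s ≤ V s := by
  induction n generalizing π s with
  | zero => exact hV0 s
  | succ n ih =>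
    refine le_trans ?_ (hV s (π [] s))
    exact add_le_add le_rfl (mul_le_mul_of_nonneg_left (M.next_mono _ _ fun x => ih _ x) h0)

/-- A stationary policy that is greedy for `V` realizes `V` up to `γ ^ n * B` in `n` steps. -/
lemma le_horizonValue_const (M : MDP S A) {γ B : ℝ} (h0 : 0 ≤ γ) {V : S → ℝ} {f : S → A}
    (hVB : ∀ s, V s ≤ B) (hV : ∀ s, V s ≤ M.r s (f s) + γ * M.next s (f s) V)
    (n : ℕ) (s : S) :
    V s - γ ^ n * B ≤ horizonValue M γ n (fun _ => f) s := by
  induction n generalizing s with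
  | zero => simpa [horizonValue] using hVB s
  | succ n ih =>
    have h1 := M.next_mono s (f s) ih
    rw [M.next_sub, M.next_const] at h1
    have h2 := mul_le_mul_of_nonneg_left h1 h0
    have h3 := hV s
    change _ ≤ M.r s (f s) + γ * M.next s (f s) (horizonValue M γ n fun _ => f)
    have : γ ^ (n + 1) * B = γ * (γ ^ n * B) := by ring
    rw [this]
    linarith

end FiniteHorizon

/-! ### The value of a policy -/

section Value

variable {S A : Type*} [Fintype S] [MeasurableSpace S] [MeasurableSingletonClass S]

/-- Playing the first `n` steps forward does not change the expected total over `n + m` steps; for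
`m = 0` this identifies the backward recursion with an expectation over trajectories. -/
lemma integral_reward_add_horizonValue (M : MDP S A) (γ : ℝ) (π : Policy S A) (s : S) (n m : ℕ) :
    ∫ ω, (∑ i ∈ Finset.range n, γ ^ i * M.r (ω i) (act π ω i) +
      γ ^ n * horizonValue M γ m (after π (past ω n)) (ω n)) ∂(trajLaw M π s) =
    horizonValue M γ (n + m) π s := by
  induction n generalizing m with
  | zero =>
    have : ∀ᵐ ω ∂(trajLaw M π s), (∑ i ∈ Finset.range 0, γ ^ i * M.r (ω i) (act π ω i) +
      γ ^ 0 * horizonValue M γ m (after π (past ω 0)) (ω 0)) = horizonValue M γ m π s := by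
      filter_upwards [ae_start M π s] with ω hω
      have : after π (past ω 0) = π := rfl
      rw [this, hω]
      simp
    rw [integral_congr_ae this]
    simp
  | succ n ih =>
    have hagree : ∀ ω ω' : ℕ → S, (∀ i ≤ n, ω i = ω' i) →
        ∑ i ∈ Finset.range (n + 1), γ ^ i * M.r (ω i) (act π ω i) =
        ∑ i ∈ Finset.range (n + 1), γ ^ i * M.r (ω' i) (act π ω' i) := by
      intro ω ω' h
      refine Finset.sum_congr rfl fun i hi => ?_
      have hi := Nat.lt_succ_iff.1 (Finset.mem_range.1 hi)
      rw [act_congr π fun j hj => h j (hj.trans hi), h i hi]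
    rw [integral_step M π s n (fun ω x => ∑ i ∈ Finset.range (n + 1),
      γ ^ i * M.r (ω i) (act π ω i) +
      γ ^ (n + 1) * horizonValue M γ m (after π (past ω (n + 1))) x) fun ω ω' h => by
        rw [hagree ω ω' h, past_congr fun i hi => h i (Nat.lt_succ_iff.1 hi)]]
    have := ih (m + 1)
    rw [show n + 1 + m = n + (m + 1) by ring, ← this]
    congr 1
    funext ω
    change M.next (ω n) (act π ω n) (fun x => _ + _ * _) = _
    rw [M.next_add, M.next_const, M.next_mul, Finset.sum_range_succ]
    have e1 : after π (past ω n) [] (ω n) = act π ω n := by simp [after, act]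
    have e2 : after (after π (past ω n)) [ω n] = after π (past ω (n + 1)) := by
      rw [past_succ]
      funext h' x
      simp [after]
    change _ = _ + γ ^ n * (M.r (ω n) (after π (past ω n) [] (ω n)) +
      γ * M.next (ω n) (after π (past ω n) [] (ω n)) (horizonValue M γ m
        (after (after π (past ω n)) [ω n])))
    rw [e1, e2]
    ring

lemma abs_value_sub_horizonValue_le (M : MDP S A) {γ : ℝ} (h0 : 0 ≤ γ) (h1 : γ < 1)
    (π : Policy S A) (s : S) (n : ℕ) :
    |value M γ π s - horizonValue M γ n π s| ≤ γ ^ n * (1 - γ)⁻¹ := by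
  set ρ : (ℕ → S) → ℕ → ℝ := fun ω i => γ ^ i * M.r (ω i) (act π ω i) with hρ
  have hρ0 : ∀ ω i, 0 ≤ ρ ω i := fun ω i => mul_nonneg (pow_nonneg h0 i) (M.r_mem _ _).1
  have hρ1 : ∀ ω i, ρ ω i ≤ γ ^ i := fun ω i =>
    mul_le_of_le_one_right (pow_nonneg h0 i) (M.r_mem _ _).2
  have hgeo := summable_geometric_of_lt_one h0 h1
  have hs : ∀ ω, Summable (ρ ω) := fun ω => Summable.of_nonneg_of_le (hρ0 ω) (hρ1 ω) hgeo
  have hpm : ∀ k, Measurable fun ω => ∑ i ∈ Finset.range k, ρ ω i := by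
    intro k
    refine measurable_of_agree k _ fun ω ω' h => Finset.sum_congr rfl fun i hi => ?_
    have hi := (Finset.mem_range.1 hi).le
    rw [hρ]
    dsimp only
    rw [act_congr π fun j hj => h j (hj.trans hi), h i hi]
  have hmeas : Measurable fun ω => ∑' i, ρ ω i :=
    measurable_of_tendsto_metrizable hpm
      (tendsto_pi_nhds.2 fun ω => (hs ω).hasSum.tendsto_sum_nat)
  have hle : ∀ ω, ∑' i, ρ ω i ≤ (1 - γ)⁻¹ := fun ω => by
    rw [← tsum_geometric_of_lt_one h0 h1]
    exact (hs ω).tsum_le_tsum (hρ1 ω) hgeo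
  have hI : Integrable (fun ω => ∑' i, ρ ω i) (trajLaw M π s) :=
    Integrable.of_bound hmeas.aestronglyMeasurable (1 - γ)⁻¹ (Filter.Eventually.of_forall fun ω => by
      rw [Real.norm_of_nonneg (tsum_nonneg (hρ0 ω))]
      exact hle ω)
  have hI2 : Integrable (fun ω => ∑ i ∈ Finset.range n, ρ ω i) (trajLaw M π s) :=
    Integrable.of_bound (hpm n).aestronglyMeasurable (1 - γ)⁻¹
      (Filter.Eventually.of_forall fun ω => by
      rw [Real.norm_of_nonneg (Finset.sum_nonneg fun i _ => hρ0 ω i)]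
      exact ((hs ω).sum_le_tsum _ fun i _ => hρ0 ω i).trans (hle ω))
  have hW := integral_reward_add_horizonValue M γ π s n 0
  simp only [horizonValue, mul_zero, add_zero] at hW
  have : value M γ π s - horizonValue M γ n π s =
      ∫ ω, (∑' i, ρ ω i - ∑ i ∈ Finset.range n, ρ ω i) ∂(trajLaw M π s) := by
    rw [integral_sub hI hI2, ← hW]
    rfl
  rw [this]
  have hd : ∀ ω, ∑' i, ρ ω i - ∑ i ∈ Finset.range n, ρ ω i = ∑' i, ρ ω (i + n) := fun ω => by
    rw [← (hs ω).sum_add_tsum_nat_add n]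
    ring
  have := norm_integral_le_of_norm_le_const (μ := trajLaw M π s)
    (f := fun ω => ∑' i, ρ ω i - ∑ i ∈ Finset.range n, ρ ω i) (C := γ ^ n * (1 - γ)⁻¹)
    (Filter.Eventually.of_forall fun ω => by
      rw [hd ω, Real.norm_of_nonneg (tsum_nonneg fun i => hρ0 ω _),
        ← tsum_geometric_of_lt_one h0 h1, ← tsum_mul_left]
      refine ((summable_nat_add_iff n).2 (hs ω)).tsum_le_tsum (fun i => ?_) (hgeo.mul_left _)
      rw [← pow_add, add_comm n i]
      exact hρ1 ω _)
  simpa using this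

lemma tendsto_horizonValue (M : MDP S A) {γ : ℝ} (h0 : 0 ≤ γ) (h1 : γ < 1)
    (π : Policy S A) (s : S) :
    Filter.Tendsto (fun n => horizonValue M γ n π s) Filter.atTop (nhds (value M γ π s)) := by
  have hz : Filter.Tendsto (fun n : ℕ => γ ^ n * (1 - γ)⁻¹) Filter.atTop (nhds 0) := by
    simpa using (tendsto_pow_atTop_nhds_zero_of_lt_one h0 h1).mul_const (1 - γ)⁻¹
  rw [tendsto_iff_norm_sub_tendsto_zero]
  refine squeeze_zero (fun n => norm_nonneg _) (fun n => ?_) hz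
  rw [← norm_neg, neg_sub]
  exact abs_value_sub_horizonValue_le M h0 h1 π s n

lemma value_nonneg (M : MDP S A) {γ : ℝ} (h0 : 0 ≤ γ) (h1 : γ < 1) (π : Policy S A) (s : S) :
    0 ≤ value M γ π s :=
  ge_of_tendsto' (tendsto_horizonValue M h0 h1 π s) fun n => horizonValue_nonneg M h0 n π s

lemma value_le_of_bellman_le (M : MDP S A) {γ : ℝ} (h0 : 0 ≤ γ) (h1 : γ < 1) {V : S → ℝ}
    (hV0 : ∀ s, 0 ≤ V s) (hV : ∀ s a, M.r s a + γ * M.next s a V ≤ V s)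
    (π : Policy S A) (s : S) : value M γ π s ≤ V s :=
  le_of_tendsto' (tendsto_horizonValue M h0 h1 π s) fun n => horizonValue_le M h0 hV0 hV n π s

lemma value_le (M : MDP S A) {γ : ℝ} (h0 : 0 ≤ γ) (h1 : γ < 1) (π : Policy S A) (s : S) :
    value M γ π s ≤ 1 / (1 - γ) := by
  have hg : 0 < 1 - γ := by linarith
  refine value_le_of_bellman_le M h0 h1 (V := fun _ => 1 / (1 - γ)) (fun _ => by positivity)
    (fun s a => ?_) π s
  rw [M.next_const]
  have := (M.r_mem s a).2
  have e : 1 / (1 - γ) = 1 + γ * (1 / (1 - γ)) := by field_simp; ring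
  linarith

/-- The Bellman equation of a history-dependent policy. -/
lemma value_eq (M : MDP S A) {γ : ℝ} (h0 : 0 ≤ γ) (h1 : γ < 1) (π : Policy S A) (s : S) :
    value M γ π s =
      M.r s (π [] s) + γ * M.next s (π [] s) (value M γ (after π [s])) := by
  have h2 := (tendsto_horizonValue M h0 h1 π s).comp (Filter.tendsto_add_atTop_nat 1)
  refine tendsto_nhds_unique h2 ?_
  refine Filter.Tendsto.const_add _ (Filter.Tendsto.const_mul _ ?_)
  exact tendsto_finsetSum _ fun x _ =>
    (tendsto_horizonValue M h0 h1 (after π [s]) x).const_mul _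

/-- The Bellman equation along a trajectory. -/
lemma value_after_past (M : MDP S A) {γ : ℝ} (h0 : 0 ≤ γ) (h1 : γ < 1) (π : Policy S A)
    (ω : ℕ → S) (t : ℕ) :
    value M γ (after π (past ω t)) (ω t) = M.r (ω t) (act π ω t) +
      γ * M.next (ω t) (act π ω t) (value M γ (after π (past ω (t + 1)))) := by
  rw [value_eq M h0 h1]
  have e1 : after π (past ω t) [] (ω t) = act π ω t := by simp [after, act]
  have e2 : after (after π (past ω t)) [ω t] = after π (past ω (t + 1)) := by
    rw [past_succ]
    funext h' x
    simp [after]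
  rw [e1, e2]

lemma value_le_optValue (M : MDP S A) {γ : ℝ} (h0 : 0 ≤ γ) (h1 : γ < 1) (π : Policy S A) (s : S) :
    value M γ π s ≤ optValue M γ s :=
  le_ciSup (f := fun π => value M γ π s)
    ⟨1 / (1 - γ), by rintro _ ⟨π, rfl⟩; exact value_le M h0 h1 π s⟩ π

lemma optValue_nonneg [Nonempty A] (M : MDP S A) {γ : ℝ} (h0 : 0 ≤ γ) (h1 : γ < 1) (s : S) :
    0 ≤ optValue M γ s :=
  (value_nonneg M h0 h1 (fun _ _ => Classical.arbitrary A) s).trans (value_le_optValue M h0 h1 _ s)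

lemma optValue_le [Nonempty A] (M : MDP S A) {γ : ℝ} (h0 : 0 ≤ γ) (h1 : γ < 1) (s : S) :
    optValue M γ s ≤ 1 / (1 - γ) := by
  have : Nonempty (Policy S A) := ⟨fun _ _ => Classical.arbitrary A⟩
  exact ciSup_le fun π => value_le M h0 h1 π s

/-- The action values of the optimal policy. -/
noncomputable def optQ (M : MDP S A) (γ : ℝ) (s : S) (a : A) : ℝ :=
  M.r s a + γ * M.next s a (optValue M γ)

lemma optQ_nonneg [Nonempty A] (M : MDP S A) {γ : ℝ} (h0 : 0 ≤ γ) (h1 : γ < 1) (s : S) (a : A) :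
    0 ≤ optQ M γ s a :=
  add_nonneg (M.r_mem s a).1 (mul_nonneg h0 (M.next_nonneg s a (optValue_nonneg M h0 h1)))

end Value

/-! ### The Bellman optimality equation -/

section OptimalValue

variable {S A : Type*} [Fintype S] [Fintype A] [Nonempty A]

lemma exists_bellman_fixedPoint (M : MDP S A) {γ : ℝ} (h0 : 0 ≤ γ) (h1 : γ < 1) :
    ∃ V : S → ℝ, ∀ s, V s = ⨆ a, (M.r s a + γ * M.next s a V) := by
  let Φ : (S → ℝ) → S → ℝ := fun V s => ⨆ a, (M.r s a + γ * M.next s a V)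
  have hle : ∀ u v : S → ℝ, ∀ s, Φ u s ≤ Φ v s + γ * dist u v := by
    intro u v s
    refine ciSup_le fun a => ?_
    have h2 : M.next s a u ≤ M.next s a v + dist u v := by
      rw [← M.next_const s a (dist u v), ← M.next_add]
      refine M.next_mono s a fun x => ?_
      have := (Real.dist_eq (u x) (v x)).symm.le.trans (dist_le_pi_dist u v x)
      linarith [le_abs_self (u x - v x)]
    have h3 := mul_le_mul_of_nonneg_left h2 h0
    have h4 := le_ciSup (f := fun a => M.r s a + γ * M.next s a v)
      (Set.finite_range _).bddAbove a
    change _ ≤ (⨆ a, (M.r s a + γ * M.next s a v)) + _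
    linarith
  have hc : ContractingWith γ.toNNReal Φ := by
    refine ⟨Real.toNNReal_lt_one.2 h1, LipschitzWith.of_dist_le_mul fun u v => ?_⟩
    rw [Real.coe_toNNReal γ h0, dist_pi_le_iff (mul_nonneg h0 dist_nonneg)]
    intro s
    rw [Real.dist_eq, abs_sub_le_iff]
    have a1 := hle u v s
    have a2 := hle v u s
    rw [dist_comm v u] at a2
    constructor <;> linarith
  exact ⟨hc.fixedPoint, fun s => congrFun hc.fixedPoint_isFixedPt.symm s⟩

variable [MeasurableSpace S] [MeasurableSingletonClass S]

/-- The Bellman optimality equation. -/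
lemma optValue_eq (M : MDP S A) {γ : ℝ} (h0 : 0 ≤ γ) (h1 : γ < 1) (s : S) :
    optValue M γ s = ⨆ a, optQ M γ s a := by
  obtain ⟨V, hV⟩ := exists_bellman_fixedPoint M h0 h1
  have hf : ∀ s, ∃ a, V s = M.r s a + γ * M.next s a V := fun s => by
    obtain ⟨a, ha⟩ := exists_eq_ciSup_of_finite (f := fun a => M.r s a + γ * M.next s a V)
    exact ⟨a, (hV s).trans ha.symm⟩
  choose f hf using hf
  have hub : ∀ s a, M.r s a + γ * M.next s a V ≤ V s := fun s a => by
    rw [hV s]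
    exact le_ciSup (f := fun a => M.r s a + γ * M.next s a V) (Set.finite_range _).bddAbove a
  -- The fixed point is the value of its greedy stationary policy.
  have hVB : ∀ s, V s ≤ ∑ x, |V x| := fun s =>
    (le_abs_self _).trans (Finset.single_le_sum (f := fun x => |V x|)
      (fun _ _ => abs_nonneg _) (Finset.mem_univ s))
  have hgr : ∀ s, V s ≤ value M γ (fun _ => f) s := fun s => by
    refine le_of_tendsto_of_tendsto' (f := fun n : ℕ => V s - γ ^ n * ∑ x, |V x|) ?_
      (tendsto_horizonValue M h0 h1 (fun _ => f) s)
      (le_horizonValue_const M h0 hVB (fun s => (hf s).le) · s)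
    simpa using ((tendsto_pow_atTop_nhds_zero_of_lt_one h0 h1).mul_const
      (∑ x, |V x|)).const_sub (V s)
  have hV0 : ∀ s, 0 ≤ V s := by
    intro s
    obtain ⟨s0, -, hs0⟩ := Finset.exists_min_image Finset.univ V ⟨s, Finset.mem_univ s⟩
    have a1 := M.next_mono s0 (f s0) fun x => hs0 x (Finset.mem_univ x)
    rw [M.next_const] at a1
    have a2 := mul_le_mul_of_nonneg_left a1 h0
    have a3 := (M.r_mem s0 (f s0)).1
    have a4 := hf s0
    have : 0 ≤ V s0 * (1 - γ) := by nlinarith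
    have := nonneg_of_mul_nonneg_left this (by linarith)
    exact this.trans (hs0 s (Finset.mem_univ s))
  have hopt : optValue M γ = V := by
    funext s
    have : Nonempty (Policy S A) := ⟨fun _ => f⟩
    exact le_antisymm (ciSup_le fun π => value_le_of_bellman_le M h0 h1 hV0 hub π s)
      ((hgr s).trans (value_le_optValue M h0 h1 _ s))
  unfold optQ
  rw [hopt]
  exact hV s

lemma optQ_le_optValue (M : MDP S A) {γ : ℝ} (h0 : 0 ≤ γ) (h1 : γ < 1) (s : S) (a : A) :
    optQ M γ s a ≤ optValue M γ s := by
  rw [optValue_eq M h0 h1]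
  exact le_ciSup (f := fun a => optQ M γ s a) (Set.finite_range _).bddAbove a

end OptimalValue

/-! ### Learning rates -/

section LearningRate

/-- The learning rate `(H + 1) / (H + k)`. -/
noncomputable def rate (H : ℝ) (k : ℕ) : ℝ := (H + 1) / (H + k)

/-- The weight that the `i`-th update keeps after `k` updates with the rates `rate H`; it is `0`
for `k < i`. -/
noncomputable def keptWeight (H : ℝ) (i k : ℕ) : ℝ :=
  if i ≤ k then rate H i * ∏ j ∈ Finset.Ioc i k, (1 - rate H j) else 0

variable {H : ℝ}

lemma rate_nonneg (hH : 0 < H) (k : ℕ) : 0 ≤ rate H k := by unfold rate; positivity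

lemma rate_one (hH : 0 < H) : rate H 1 = 1 := by
  unfold rate
  rw [Nat.cast_one]
  exact div_self (by positivity)

lemma one_sub_rate_succ (hH : 0 < H) (k : ℕ) : 1 - rate H (k + 1) = k / (H + k + 1) := by
  unfold rate
  push_cast
  field_simp
  ring

lemma one_sub_rate_succ_nonneg (hH : 0 < H) (k : ℕ) : 0 ≤ 1 - rate H (k + 1) := by
  rw [one_sub_rate_succ hH]; positivity

lemma keptWeight_of_lt {i k : ℕ} (h : k < i) : keptWeight H i k = 0 := if_neg (by omega)

lemma keptWeight_self (i : ℕ) : keptWeight H i i = rate H i := by simp [keptWeight]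

lemma keptWeight_succ {i k : ℕ} (h : i ≤ k) :
    keptWeight H i (k + 1) = (1 - rate H (k + 1)) * keptWeight H i k := by
  rw [keptWeight, keptWeight, if_pos h, if_pos (h.trans k.le_succ),
    Finset.prod_Ioc_succ_top h]
  ring

lemma keptWeight_nonneg (hH : 0 < H) (i k : ℕ) : 0 ≤ keptWeight H i k := by
  unfold keptWeight
  split_ifs
  · refine mul_nonneg (rate_nonneg hH i) (Finset.prod_nonneg fun j hj => ?_)
    obtain ⟨j, rfl⟩ : ∃ j', j = j' + 1 := ⟨j - 1, by have := (Finset.mem_Ioc.1 hj).1; omega⟩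
    exact one_sub_rate_succ_nonneg hH j
  · exact le_rfl

/-- This is the variance proxy of the averaged sampling errors. -/
lemma sum_keptWeight_sq_le (hH : 0 < H) (k : ℕ) :
    ∑ i ∈ Finset.range (k + 1), keptWeight H (i + 1) (k + 1) ^ 2 ≤ rate H (k + 1) := by
  induction k with
  | zero => simp [keptWeight_self, rate_one hH]
  | succ k ih =>
    rw [Finset.sum_range_succ, keptWeight_self]
    have e : ∑ i ∈ Finset.range (k + 1), keptWeight H (i + 1) (k + 1 + 1) ^ 2 =
        (1 - rate H (k + 1 + 1)) ^ 2 *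
          ∑ i ∈ Finset.range (k + 1), keptWeight H (i + 1) (k + 1) ^ 2 := by
      rw [Finset.mul_sum]
      refine Finset.sum_congr rfl fun i hi => ?_
      rw [keptWeight_succ (by have := Finset.mem_range.1 hi; omega), mul_pow]
    rw [e]
    have h0 := one_sub_rate_succ_nonneg hH (k + 1)
    have h1 : (1 - rate H (k + 1 + 1)) * rate H (k + 1) ≤ rate H (k + 1 + 1) := by
      rw [one_sub_rate_succ hH]
      unfold rate
      push_cast
      have : ((k : ℝ) + 1) / (H + (k + 1) + 1) * ((H + 1) / (H + (k + 1))) =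
        (H + 1) / (H + (k + 1 + 1)) * ((k + 1) / (H + (k + 1))) := by
        field_simp
        ring
      rw [this]
      refine mul_le_of_le_one_right (by positivity) ?_
      rw [div_le_one (by positivity)]
      linarith
    calc _ ≤ (1 - rate H (k + 1 + 1)) ^ 2 * rate H (k + 1) + rate H (k + 1 + 1) ^ 2 := by gcongr
      _ = (1 - rate H (k + 1 + 1)) * ((1 - rate H (k + 1 + 1)) * rate H (k + 1)) +
          rate H (k + 1 + 1) ^ 2 := by ring
      _ ≤ (1 - rate H (k + 1 + 1)) * rate H (k + 1 + 1) + rate H (k + 1 + 1) ^ 2 := by gcongr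
      _ = rate H (k + 1 + 1) := by ring

/-- A single update weighs at most `1 + 1 / H` in all later averages together. -/
lemma sum_keptWeight_le (hH : 0 < H) {i : ℕ} (hi : 1 ≤ i) (n : ℕ) :
    ∑ k ∈ Finset.range n, keptWeight H i k ≤ 1 + 1 / H := by
  -- The sum telescopes, because `H * keptWeight i (k + 1)` is a difference of consecutive values
  -- of `k * keptWeight i k`.
  have key : ∀ m, ∑ k ∈ Finset.range (i + m + 1), keptWeight H i k +
      (i + m : ℕ) / H * keptWeight H i (i + m) = 1 + 1 / H := by
    intro m
    induction m with
    | zero =>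
      rw [add_zero, Finset.sum_range_succ, Finset.sum_eq_zero fun k hk =>
        keptWeight_of_lt (Finset.mem_range.1 hk), keptWeight_self, rate]
      field_simp
      ring
    | succ m ih =>
      rw [← ih, ← add_assoc, Finset.sum_range_succ _ (i + m + 1),
        keptWeight_succ (Nat.le_add_right i m), one_sub_rate_succ hH]
      push_cast
      field_simp
      ring
  have h := key n
  have hnn : 0 ≤ ((i + n : ℕ) : ℝ) / H * keptWeight H i (i + n) :=
    mul_nonneg (by positivity) (keptWeight_nonneg hH _ _)
  have hsub : ∑ k ∈ Finset.range n, keptWeight H i k ≤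
      ∑ k ∈ Finset.range (i + n + 1), keptWeight H i k :=
    Finset.sum_le_sum_of_subset_of_nonneg (Finset.range_mono (by omega))
      fun k _ _ => keptWeight_nonneg hH _ _
  linarith

end LearningRate

/-! ### Visit counts and averages over visits -/

section Visits

variable {Z : Type*} [DecidableEq Z]

/-- The number of visits of the sequence `x` to `z` strictly before time `t`. -/
def visits (x : ℕ → Z) (z : Z) (t : ℕ) : ℕ := Nat.count (fun u => x u = z) t

lemma visits_zero (x : ℕ → Z) (z : Z) : visits x z 0 = 0 := Nat.count_zero _

lemma visits_succ (x : ℕ → Z) (z : Z) (t : ℕ) :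
    visits x z (t + 1) = visits x z t + if x t = z then 1 else 0 := Nat.count_succ _ _

lemma visits_mono (x : ℕ → Z) (z : Z) {t u : ℕ} (h : t ≤ u) : visits x z t ≤ visits x z u :=
  Nat.count_monotone _ h

lemma visits_le (x : ℕ → Z) (z : Z) (t : ℕ) : visits x z t ≤ t := Nat.count_le _

lemma visits_lt {x : ℕ → Z} {z : Z} {u t : ℕ} (hu : x u = z) (h : u < t) :
    visits x z u < visits x z t := by
  have := visits_mono x z (Nat.succ_le_of_lt h)
  rw [Nat.succ_eq_add_one, visits_succ, if_pos hu] at this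
  omega

lemma sum_of_visits_eq (x : ℕ → Z) (z : Z) (f : ℕ → ℝ) (T : ℕ) :
    ∑ t ∈ Finset.range T, (if x t = z then f (visits x z t) else 0) =
      ∑ n ∈ Finset.range (visits x z T), f n := by
  induction T with
  | zero => simp [visits_zero]
  | succ T ih =>
    rw [Finset.sum_range_succ, ih, visits_succ]
    split_ifs with h
    · rw [Finset.sum_range_succ]
    · simp

lemma sum_of_visits_self_eq [Fintype Z] (x : ℕ → Z) (f : ℕ → ℝ) (T : ℕ) :
    ∑ t ∈ Finset.range T, f (visits x (x t) t) =
      ∑ z, ∑ n ∈ Finset.range (visits x z T), f n := by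
  simp_rw [← sum_of_visits_eq]
  rw [Finset.sum_comm]
  refine Finset.sum_congr rfl fun t _ => ?_
  simp

/-- The average of the values `y u` at the visits `u < t` to `z`, with the weights that result
from the learning rates. -/
noncomputable def visitAvg (H : ℝ) (x : ℕ → Z) (z : Z) (t : ℕ) (y : ℕ → ℝ) : ℝ :=
  ∑ u ∈ Finset.range t,
    if x u = z then keptWeight H (visits x z u + 1) (visits x z t) * y u else 0

variable {H : ℝ} {x : ℕ → Z} {z : Z} {t : ℕ}

lemma visitAvg_succ_of_ne (h : x t ≠ z) (y : ℕ → ℝ) :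
    visitAvg H x z (t + 1) y = visitAvg H x z t y := by
  unfold visitAvg
  rw [Finset.sum_range_succ, if_neg h, visits_succ, if_neg h, add_zero, add_zero]

lemma visitAvg_succ_of_eq (h : x t = z) (y : ℕ → ℝ) :
    visitAvg H x z (t + 1) y = (1 - rate H (visits x z t + 1)) * visitAvg H x z t y +
      rate H (visits x z t + 1) * y t := by
  unfold visitAvg
  rw [Finset.sum_range_succ, if_pos h, visits_succ, if_pos h, keptWeight_self, Finset.mul_sum]
  congr 1
  refine Finset.sum_congr rfl fun u hu => ?_
  split_ifs with hx
  · rw [keptWeight_succ (visits_lt hx (Finset.mem_range.1 hu))]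
    ring
  · simp

lemma visitAvg_eq_zero (h : visits x z t = 0) (y : ℕ → ℝ) : visitAvg H x z t y = 0 := by
  refine Finset.sum_eq_zero fun u _ => ?_
  split_ifs
  · rw [keptWeight_of_lt (by omega), zero_mul]
  · rfl

lemma visitAvg_mono (hH : 0 < H) {y y' : ℕ → ℝ} (h : ∀ u < t, x u = z → y u ≤ y' u) :
    visitAvg H x z t y ≤ visitAvg H x z t y' := by
  refine Finset.sum_le_sum fun u hu => ?_
  split_ifs with hx
  · exact mul_le_mul_of_nonneg_left (h u (Finset.mem_range.1 hu) hx) (keptWeight_nonneg hH _ _)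
  · exact le_rfl

lemma visitAvg_add (y y' : ℕ → ℝ) :
    visitAvg H x z t (fun u => y u + y' u) = visitAvg H x z t y + visitAvg H x z t y' := by
  unfold visitAvg
  rw [← Finset.sum_add_distrib]
  refine Finset.sum_congr rfl fun u _ => ?_
  split_ifs <;> ring

lemma visitAvg_mul (c : ℝ) (y : ℕ → ℝ) :
    visitAvg H x z t (fun u => c * y u) = c * visitAvg H x z t y := by
  unfold visitAvg
  rw [Finset.mul_sum]
  refine Finset.sum_congr rfl fun u _ => ?_
  split_ifs <;> ring

lemma visitAvg_eq_sum_range (y : ℕ → ℝ) {T : ℕ} (h : t ≤ T) :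
    visitAvg H x z t y = ∑ u ∈ Finset.range T,
      if x u = z then keptWeight H (visits x z u + 1) (visits x z t) * y u else 0 := by
  refine Finset.sum_subset (Finset.range_mono h) fun u _ hu => ?_
  have hu : t ≤ u := by simpa using hu
  have := visits_mono x z hu
  rw [keptWeight_of_lt (by omega), zero_mul, ite_self]

/-- The weights form a probability vector, once `z` has been visited. -/
lemma visitAvg_one (hH : 0 < H) (h : 0 < visits x z t) : visitAvg H x z t (fun _ => 1) = 1 := by
  induction t with
  | zero => simp [visits_zero] at h
  | succ t ih =>
    by_cases hx : x t = z
    · rw [visitAvg_succ_of_eq hx]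
      rcases Nat.eq_zero_or_pos (visits x z t) with h0 | h0
      · rw [h0, visitAvg_eq_zero h0, zero_add, rate_one hH]; norm_num
      · rw [ih h0]; ring
    · rw [visitAvg_succ_of_ne hx]
      rw [visits_succ, if_neg hx, add_zero] at h
      exact ih h

lemma visitAvg_one_le (hH : 0 < H) : visitAvg H x z t (fun _ => 1) ≤ 1 := by
  rcases Nat.eq_zero_or_pos (visits x z t) with h | h
  · rw [visitAvg_eq_zero h]; exact zero_le_one
  · exact (visitAvg_one hH h).le

lemma visitAvg_const (hH : 0 < H) (h : 0 < visits x z t) (c : ℝ) :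
    visitAvg H x z t (fun _ => c) = c := by
  have := visitAvg_mul (H := H) (x := x) (z := z) (t := t) c (fun _ => 1)
  rw [visitAvg_one hH h] at this
  simpa using this

lemma visitAvg_inv_sqrt_le (hH : 0 < H) (h : 0 < visits x z t) :
    visitAvg H x z t (fun u => 1 / √(visits x z u + 1 : ℕ)) ≤ 2 / √(visits x z t) := by
  induction t with
  | zero => simp [visits_zero] at h
  | succ t ih =>
    by_cases hx : x t = z
    · rw [visitAvg_succ_of_eq hx, visits_succ, if_pos hx]
      rcases Nat.eq_zero_or_pos (visits x z t) with h0 | h0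
      · rw [h0, visitAvg_eq_zero h0, zero_add, rate_one hH]; norm_num
      · have ih := ih h0
        have ha := one_sub_rate_succ_nonneg hH (visits x z t)
        refine (add_le_add (mul_le_mul_of_nonneg_left ih ha) le_rfl).trans ?_
        rw [one_sub_rate_succ hH, rate]
        set k : ℝ := (visits x z t : ℝ) with hk
        have hk0 : 0 < k := by rw [hk]; exact_mod_cast h0
        push_cast
        rw [← hk]
        set p := √k with hp
        set q := √(k + 1) with hq
        have hp0 : 0 < p := Real.sqrt_pos.2 hk0
        have hq0 : 0 < q := Real.sqrt_pos.2 (by linarith)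
        have hp2 : p ^ 2 = k := Real.sq_sqrt hk0.le
        have hq2 : q ^ 2 = k + 1 := Real.sq_sqrt (by linarith)
        have e : k / (H + k + 1) * (2 / p) + (H + 1) / (H + (k + 1)) * (1 / q) =
            (2 * p * q + H + 1) / ((H + k + 1) * q) := by
          rw [← hp2]
          field_simp
          ring
        rw [e, div_le_div_iff₀ (by positivity) hq0]
        nlinarith [sq_nonneg (p - q), mul_pos hp0 hq0]
    · rw [visitAvg_succ_of_ne hx]
      have e : visits x z (t + 1) = visits x z t := by rw [visits_succ, if_neg hx, add_zero]
      rw [e] at h ⊢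
      exact ih h

end Visits

/-! ### Weighted sums of errors -/

section WeightedErrors

/-- A thresholded form of `∑ 1 / √n ≤ 2 √N`: the increments of `2 min (√n) (1 / θ)` dominate the
excess of `1 / √n` over `θ`. -/
lemma inv_sqrt_le_add_increment {θ : ℝ} (hθ : 0 < θ) (n : ℕ) :
    1 / √(n : ℝ) ≤ θ + (2 * min (√(n : ℝ)) (1 / θ) - 2 * min (√((n - 1 : ℕ) : ℝ)) (1 / θ)) := by
  rcases n with _ | n
  · simp [hθ.le]
  · simp only [Nat.add_sub_cancel]
    have hp0 : 0 ≤ √(n : ℝ) := Real.sqrt_nonneg _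
    have hq0 : 0 < √((n + 1 : ℕ) : ℝ) := Real.sqrt_pos.2 (by positivity)
    have hp2 : √(n : ℝ) ^ 2 = n := Real.sq_sqrt (by positivity)
    have hq2 : √((n + 1 : ℕ) : ℝ) ^ 2 = n + 1 := by
      rw [Real.sq_sqrt (by positivity)]; push_cast; ring
    have hpq : √(n : ℝ) ≤ √((n + 1 : ℕ) : ℝ) := Real.sqrt_le_sqrt (by push_cast; linarith)
    set p := √(n : ℝ)
    set q := √((n + 1 : ℕ) : ℝ)
    rcases le_total q (1 / θ) with h | h
    · rw [min_eq_left h, min_eq_left (hpq.trans h)]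
      have : 1 / q ≤ 2 * q - 2 * p := by
        rw [div_le_iff₀ hq0]
        nlinarith [sq_nonneg (q - p)]
      linarith
    · have h1 : 1 / q ≤ θ := by
        rw [div_le_iff₀ hq0]
        rw [div_le_iff₀ hθ] at h
        linarith
      have h2 : min p (1 / θ) ≤ min q (1 / θ) := min_le_min_right _ hpq
      linarith

lemma sum_increment_le {θ : ℝ} (hθ : 0 < θ) (N : ℕ) :
    ∑ n ∈ Finset.range N,
      (2 * min (√(n : ℝ)) (1 / θ) - 2 * min (√((n - 1 : ℕ) : ℝ)) (1 / θ)) ≤ 2 / θ := by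
  have key : ∀ N, ∑ n ∈ Finset.range (N + 1),
      (2 * min (√(n : ℝ)) (1 / θ) - 2 * min (√((n - 1 : ℕ) : ℝ)) (1 / θ)) =
      2 * min (√(N : ℝ)) (1 / θ) := by
    intro N
    induction N with
    | zero => simp [hθ.le]
    | succ N ih => rw [Finset.sum_range_succ, ih]; simp
  rcases N with _ | N
  · rw [Finset.range_zero, Finset.sum_empty]
    positivity
  · rw [key, mul_comm, ← le_div_iff₀ two_pos]
    refine (min_le_right _ _).trans (le_of_eq ?_)
    field_simp

variable {Z : Type*} [DecidableEq Z]

/-- The weights with which the errors at the time `u + 1` enter, after one step of the recursion,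
a sum of errors with the weights `w`. -/
noncomputable def pushedWeight (H : ℝ) (x : ℕ → Z) (w : ℕ → ℝ) (T u : ℕ) : ℝ :=
  ∑ t ∈ Finset.range T,
    if x t = x u then w t * keptWeight H (visits x (x u) u + 1) (visits x (x u) t) else 0

lemma sum_mul_visitAvg {H : ℝ} (x : ℕ → Z) (w y : ℕ → ℝ) (T : ℕ) :
    ∑ t ∈ Finset.range T, w t * visitAvg H x (x t) t y =
      ∑ u ∈ Finset.range T, pushedWeight H x w T u * y u := by
  have h1 : ∀ t ∈ Finset.range T, w t * visitAvg H x (x t) t y =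
      ∑ u ∈ Finset.range T, (if x t = x u then
        w t * keptWeight H (visits x (x u) u + 1) (visits x (x u) t) else 0) * y u := by
    intro t ht
    rw [visitAvg_eq_sum_range y (Finset.mem_range.1 ht).le, Finset.mul_sum]
    refine Finset.sum_congr rfl fun u _ => ?_
    by_cases h : x t = x u
    · rw [if_pos h, if_pos h.symm, h]; ring
    · rw [if_neg h, if_neg (Ne.symm h)]; ring
  rw [Finset.sum_congr rfl h1, Finset.sum_comm]
  refine Finset.sum_congr rfl fun u _ => ?_
  rw [pushedWeight, Finset.sum_mul]

lemma pushedWeight_nonneg {H : ℝ} (hH : 0 < H) (x : ℕ → Z) {w : ℕ → ℝ} (hw : ∀ t, 0 ≤ w t)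
    (T u : ℕ) : 0 ≤ pushedWeight H x w T u := by
  refine Finset.sum_nonneg fun t _ => ?_
  split_ifs
  · exact mul_nonneg (hw t) (keptWeight_nonneg hH _ _)
  · exact le_rfl

lemma pushedWeight_le {H W : ℝ} (hH : 0 < H) (x : ℕ → Z) {w : ℕ → ℝ} (hw : ∀ t, w t ≤ W)
    (hW : 0 ≤ W) (T u : ℕ) : pushedWeight H x w T u ≤ (1 + 1 / H) * W := by
  have h1 : pushedWeight H x w T u ≤ ∑ t ∈ Finset.range T,
      if x t = x u then W * keptWeight H (visits x (x u) u + 1) (visits x (x u) t) else 0 := by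
    refine Finset.sum_le_sum fun t _ => ?_
    split_ifs
    · exact mul_le_mul_of_nonneg_right (hw t) (keptWeight_nonneg hH _ _)
    · exact le_rfl
  refine h1.trans ?_
  rw [sum_of_visits_eq x (x u) (fun n => W * keptWeight H (visits x (x u) u + 1) n),
    ← Finset.mul_sum, mul_comm]
  exact mul_le_mul_of_nonneg_right (sum_keptWeight_le hH (Nat.le_add_left 1 _) _) hW

lemma pushedWeight_last {H : ℝ} (x : ℕ → Z) (w : ℕ → ℝ) (T : ℕ) :
    pushedWeight H x w (T + 1) T = 0 := by
  refine Finset.sum_eq_zero fun t ht => ?_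
  have := visits_mono x (x T) (Nat.lt_succ_iff.1 (Finset.mem_range.1 ht))
  rw [keptWeight_of_lt (by omega), mul_zero, ite_self]

lemma sum_pushedWeight_le {H : ℝ} (hH : 0 < H) (x : ℕ → Z) {w : ℕ → ℝ} (hw : ∀ t, 0 ≤ w t)
    (T : ℕ) :
    ∑ u ∈ Finset.range T, pushedWeight H x w T u ≤ ∑ t ∈ Finset.range T, w t := by
  have h := sum_mul_visitAvg (H := H) x w (fun _ => 1) T
  simp only [mul_one] at h
  rw [← h]
  exact Finset.sum_le_sum fun t _ => mul_le_of_le_one_right (hw t) (visitAvg_one_le hH)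

/-- Weighted sums of the errors `φ` of a Q-learning table.  The error at time `t` is at most a
statistical term `E + F / √n`, with `n` the number of earlier visits, plus `γ` times the average
of the errors `ψ` at the successors of the earlier visits, and `ψ u` is controlled by the error
at time `u + 1`.  Unrolling this recursion multiplies the largest weight by `1 + 1 / H` and the
total by `γ`, so that the bound on a single step is amplified by `O(1 / (1 - γ))` only. -/
theorem sum_weighted_error_le [Fintype Z] {H γ B E F θ : ℝ} (hH : 0 < H) (hγ0 : 0 ≤ γ) (hγ1 : γ < 1)
    (hHγ : γ * (1 + 1 / H) ≤ (1 + γ) / 2) (hB : 0 ≤ B) (hE : 0 ≤ E) (hF : 0 ≤ F) (hθ : 0 < θ)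
    (x : ℕ → Z) (φ ψ d : ℕ → ℝ) (T : ℕ) (hφB : ∀ t < T, φ t ≤ B)
    (hφ : ∀ t < T, 0 < visits x (x t) t →
      φ t ≤ E + F * (1 / √(visits x (x t) t : ℝ)) + γ * visitAvg H x (x t) t ψ)
    (hψ : ∀ u, u + 1 < T → ψ u ≤ φ (u + 1) + d u)
    (hd0 : ∀ u, 0 ≤ d u) (hd : ∑ u ∈ Finset.range T, d u ≤ Fintype.card Z * B)
    (w : ℕ → ℝ) (W : ℝ) (hw0 : ∀ t, 0 ≤ w t) (hwW : ∀ t, w t ≤ W) :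
    ∑ t ∈ Finset.range T, w t * φ t ≤
      2 / (1 - γ) * (Fintype.card Z * (2 * B + 2 * F / θ)) * W +
        (E + F * θ) / (1 - γ) * ∑ t ∈ Finset.range T, w t := by
  have hg : 0 < 1 - γ := by linarith
  set K : ℝ := (Fintype.card Z : ℝ) with hK
  have hK0 : 0 ≤ K := Nat.cast_nonneg _
  set D : ℝ := K * (2 * B + 2 * F / θ) with hD
  have hD0 : 0 ≤ D := by positivity
  have hq1 : γ * (1 + 1 / H) ≤ 1 := by linarith
  -- `j` counts the unrollings; the remainder `γ ^ j * (B * C)` vanishes in the limit.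
  have key : ∀ (j : ℕ) (w : ℕ → ℝ) (W : ℝ), (∀ t, 0 ≤ w t) → (∀ t, w t ≤ W) →
      ∑ t ∈ Finset.range T, w t * φ t ≤ 2 / (1 - γ) * D * W +
        (E + F * θ) / (1 - γ) * ∑ t ∈ Finset.range T, w t +
        γ ^ j * (B * ∑ t ∈ Finset.range T, w t) := by
    intro j
    induction j with
    | zero =>
      intro w W hw0 hwW
      have hW : 0 ≤ W := (hw0 0).trans (hwW 0)
      have hC : 0 ≤ ∑ t ∈ Finset.range T, w t := Finset.sum_nonneg fun t _ => hw0 t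
      have h1 : ∑ t ∈ Finset.range T, w t * φ t ≤ B * ∑ t ∈ Finset.range T, w t := by
        rw [Finset.mul_sum]
        refine Finset.sum_le_sum fun t ht => ?_
        rw [mul_comm B]
        exact mul_le_mul_of_nonneg_left (hφB t (Finset.mem_range.1 ht)) (hw0 t)
      have h2 : 0 ≤ 2 / (1 - γ) * D * W := by positivity
      have h3 : 0 ≤ (E + F * θ) / (1 - γ) * ∑ t ∈ Finset.range T, w t := by positivity
      rw [pow_zero, one_mul]
      linarith
    | succ j ih =>
      intro w W hw0 hwW
      have hW : 0 ≤ W := (hw0 0).trans (hwW 0)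
      set C := ∑ t ∈ Finset.range T, w t with hCdef
      have hC : 0 ≤ C := Finset.sum_nonneg fun t _ => hw0 t
      set inc : ℕ → ℝ := fun n =>
        2 * min (√(n : ℝ)) (1 / θ) - 2 * min (√((n - 1 : ℕ) : ℝ)) (1 / θ) with hinc
      have hinc0 : ∀ n, 0 ≤ inc n := fun n => by
        have : √((n - 1 : ℕ) : ℝ) ≤ √(n : ℝ) :=
          Real.sqrt_le_sqrt (by exact_mod_cast Nat.sub_le n 1)
        have := min_le_min_right (1 / θ) this
        simp only [hinc]
        linarith
      have hpt : ∀ t ∈ Finset.range T, w t * φ t ≤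
          W * B * (if visits x (x t) t = 0 then 1 else 0) + (E + F * θ) * w t +
          W * F * inc (visits x (x t) t) + γ * (w t * visitAvg H x (x t) t ψ) := by
        intro t ht
        have ht := Finset.mem_range.1 ht
        have hi := mul_nonneg (mul_nonneg hW hF) (hinc0 (visits x (x t) t))
        rcases Nat.eq_zero_or_pos (visits x (x t) t) with h0 | h0
        · rw [if_pos h0, visitAvg_eq_zero h0]
          have h1 := (mul_le_mul_of_nonneg_left (hφB t ht) (hw0 t)).trans
            (mul_le_mul_of_nonneg_right (hwW t) hB)
          have h2 : 0 ≤ (E + F * θ) * w t := mul_nonneg (by positivity) (hw0 t)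
          linarith
        · rw [if_neg h0.ne']
          have h1 := mul_le_mul_of_nonneg_left (hφ t ht h0) (hw0 t)
          have h2 := mul_le_mul_of_nonneg_left
            (inv_sqrt_le_add_increment hθ (visits x (x t) t)) (mul_nonneg (hw0 t) hF)
          have h3 := mul_le_mul_of_nonneg_right (hwW t)
            (mul_nonneg hF (hinc0 (visits x (x t) t)))
          simp only [hinc] at h3 ⊢
          nlinarith [h1, h2, h3]
      have hsum := Finset.sum_le_sum hpt
      rw [Finset.sum_add_distrib, Finset.sum_add_distrib, Finset.sum_add_distrib,
        ← Finset.mul_sum, ← Finset.mul_sum, ← Finset.mul_sum, ← Finset.mul_sum,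
        sum_mul_visitAvg x w ψ T, ← hCdef] at hsum
      have hfirst : ∑ t ∈ Finset.range T, (if visits x (x t) t = 0 then (1 : ℝ) else 0) ≤ K := by
        rw [sum_of_visits_self_eq x (fun n => if n = 0 then (1 : ℝ) else 0)]
        calc _ ≤ ∑ _z : Z, (1 : ℝ) := by
              refine Finset.sum_le_sum fun z _ => ?_
              rw [Finset.sum_ite_eq']
              split_ifs <;> norm_num
          _ = K := by simp [hK]
      have hinc_sum : ∑ t ∈ Finset.range T, inc (visits x (x t) t) ≤ K * (2 / θ) := by
        rw [sum_of_visits_self_eq x inc]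
        calc _ ≤ ∑ _z : Z, 2 / θ := Finset.sum_le_sum fun z _ => sum_increment_le hθ _
          _ = K * (2 / θ) := by simp [hK]
      set w' : ℕ → ℝ := fun t => if t = 0 then 0 else pushedWeight H x w T (t - 1) with hw'
      have hw'0 : ∀ t, 0 ≤ w' t := fun t => by
        simp only [hw']
        split_ifs
        · exact le_rfl
        · exact pushedWeight_nonneg hH x hw0 T _
      have hqW : 0 ≤ (1 + 1 / H) * W := by positivity
      have hw'W : ∀ t, w' t ≤ (1 + 1 / H) * W := fun t => by
        simp only [hw']
        split_ifs
        · exact hqW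
        · exact pushedWeight_le hH x hwW hW T _
      have hpush : ∑ u ∈ Finset.range T, pushedWeight H x w T u * ψ u ≤
          ∑ t ∈ Finset.range T, w' t * φ t + (1 + 1 / H) * W * (K * B) := by
        have h1 : ∑ u ∈ Finset.range T, pushedWeight H x w T u * d u ≤
            (1 + 1 / H) * W * (K * B) := by
          calc _ ≤ ∑ u ∈ Finset.range T, (1 + 1 / H) * W * d u :=
                Finset.sum_le_sum fun u _ =>
                  mul_le_mul_of_nonneg_right (pushedWeight_le hH x hwW hW T u) (hd0 u)
            _ = (1 + 1 / H) * W * ∑ u ∈ Finset.range T, d u := by rw [Finset.mul_sum]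
            _ ≤ _ := mul_le_mul_of_nonneg_left hd hqW
        refine le_trans ?_ (add_le_add le_rfl h1)
        rcases T with _ | T
        · simp
        · rw [Finset.sum_range_succ, pushedWeight_last, zero_mul, add_zero,
            Finset.sum_range_succ' (fun t => w' t * φ t),
            Finset.sum_range_succ (fun u => pushedWeight H x w (T + 1) u * d u),
            pushedWeight_last, zero_mul, add_zero]
          have e0 : w' 0 = 0 := by simp [hw']
          have e1 : ∀ u, w' (u + 1) = pushedWeight H x w (T + 1) u := fun u => by simp [hw']
          rw [e0, zero_mul, add_zero, ← Finset.sum_add_distrib]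
          refine Finset.sum_le_sum fun u hu => ?_
          rw [e1, ← mul_add]
          exact mul_le_mul_of_nonneg_left
            (hψ u (by have := Finset.mem_range.1 hu; omega)) (pushedWeight_nonneg hH x hw0 _ _)
      have hC' : ∑ t ∈ Finset.range T, w' t ≤ C := by
        refine le_trans ?_ (sum_pushedWeight_le hH x hw0 T)
        rcases T with _ | T
        · simp
        · rw [Finset.sum_range_succ', Finset.sum_range_succ, pushedWeight_last]
          simp [hw']
      have hih := ih w' ((1 + 1 / H) * W) hw'0 hw'W
      set C' := ∑ t ∈ Finset.range T, w' t
      have hih' : ∑ t ∈ Finset.range T, w' t * φ t ≤ 2 / (1 - γ) * D * ((1 + 1 / H) * W) +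
          (E + F * θ) / (1 - γ) * C + γ ^ j * (B * C) := by
        refine hih.trans ?_
        gcongr
      have a1 := mul_le_mul_of_nonneg_left hfirst (mul_nonneg hW hB)
      have a2 := mul_le_mul_of_nonneg_left hinc_sum (mul_nonneg hW hF)
      have a3 := mul_le_mul_of_nonneg_left (hpush.trans (add_le_add hih' le_rfl)) hγ0
      have a4 : γ * (1 + 1 / H) * (W * (K * B)) ≤ W * (K * B) :=
        mul_le_of_le_one_left (by positivity) hq1
      have a5 : γ * (1 + 1 / H) * (2 / (1 - γ) * D * W) ≤
          (1 + γ) / 2 * (2 / (1 - γ) * D * W) :=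
        mul_le_mul_of_nonneg_right hHγ (by positivity)
      have a6 : (1 + γ) / 2 * (2 / (1 - γ) * D * W) = 2 / (1 - γ) * D * W - D * W := by
        field_simp
        ring
      have a7 : γ * ((E + F * θ) / (1 - γ) * C) + (E + F * θ) * C =
          (E + F * θ) / (1 - γ) * C := by
        field_simp
        ring
      have a8 : D * W = 2 * (W * (K * B)) + W * F * (K * (2 / θ)) := by
        rw [hD]
        ring
      rw [pow_succ]
      linarith
  refine le_of_forall_pos_le_add fun η hη => ?_
  set C := ∑ t ∈ Finset.range T, w t
  have hlim : Filter.Tendsto (fun j : ℕ => γ ^ j * (B * C)) Filter.atTop (nhds 0) := by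
    simpa using (tendsto_pow_atTop_nhds_zero_of_lt_one hγ0 hγ1).mul_const (B * C)
  obtain ⟨j, hj⟩ := (hlim.eventually (gt_mem_nhds hη)).exists
  exact (key j w W hw0 hwW).trans (by linarith)

end WeightedErrors

/-! ### Bonuses -/

section Bonus

lemma sqrt_add_le {a b : ℝ} (ha : 0 ≤ a) (hb : 0 ≤ b) : √(a + b) ≤ √a + √b := by
  rw [Real.sqrt_le_left (by positivity)]
  nlinarith [Real.sq_sqrt ha, Real.sq_sqrt hb, mul_nonneg (Real.sqrt_nonneg a) (Real.sqrt_nonneg b)]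

variable {m : ℕ} {ε δ γ : ℝ}

lemma log_succ_mul_le_iota (hm : 1 ≤ m) (hδ0 : 0 < δ) (hδ1 : δ ≤ 1) (k : ℕ) :
    Real.log (k + 1) + Real.log (k + 2) ≤ iota m δ k := by
  unfold iota
  rw [← Real.log_mul (by positivity) (by positivity)]
  refine Real.log_le_log (by positivity) ?_
  rw [le_div_iff₀ hδ0]
  have hm' : (1 : ℝ) ≤ m := by exact_mod_cast hm
  have h0 : (0 : ℝ) ≤ (k + 1) * (k + 2) := by positivity
  calc ((k : ℝ) + 1) * (k + 2) * δ ≤ (k + 1) * (k + 2) * 1 := by gcongr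
    _ = 1 * ((k + 1) * (k + 2)) := by ring
    _ ≤ m * ((k + 1) * (k + 2)) := by gcongr
    _ = m * (k + 1) * (k + 2) := by ring

lemma iota_nonneg (hm : 1 ≤ m) (hδ0 : 0 < δ) (hδ1 : δ ≤ 1) (k : ℕ) : 0 ≤ iota m δ k :=
  (add_nonneg (Real.log_nonneg (by linarith [Nat.cast_nonneg (α := ℝ) k]))
    (Real.log_nonneg (by linarith [Nat.cast_nonneg (α := ℝ) k]))).trans
    (log_succ_mul_le_iota hm hδ0 hδ1 k)

lemma iota_mono (hm : 1 ≤ m) (hδ0 : 0 < δ) {i k : ℕ} (h : i ≤ k) : iota m δ i ≤ iota m δ k := by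
  have hm' : (0 : ℝ) < m := by exact_mod_cast hm
  unfold iota
  refine Real.log_le_log (by positivity) ?_
  gcongr

lemma iota_eq (hm : 1 ≤ m) (hδ0 : 0 < δ) (k : ℕ) :
    iota m δ k = Real.log (m / δ) + (Real.log (k + 1) + Real.log (k + 2)) := by
  have hm' : (0 : ℝ) < m := by exact_mod_cast hm
  unfold iota
  rw [← Real.log_mul (by positivity) (by positivity),
    ← Real.log_mul (by positivity) (by positivity)]
  congr 1
  ring

/-- The confidence level grows more slowly than the visit count. -/
lemma iota_div_antitone (hm : 1 ≤ m) (hδ0 : 0 < δ) (hδ1 : δ ≤ 1) {i k : ℕ} (hi : 1 ≤ i)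
    (h : i ≤ k) : iota m δ k / k ≤ iota m δ i / i := by
  induction k, h using Nat.le_induction with
  | base => exact le_rfl
  | succ k hik ih =>
    refine le_trans ?_ ih
    have hk : (0 : ℝ) < k := by exact_mod_cast (show 0 < k by omega)
    rw [div_le_div_iff₀ (by positivity) hk]
    have h1 := log_succ_mul_le_iota hm hδ0 hδ1 k
    have h2 := Real.one_sub_inv_le_log_of_pos (show (0 : ℝ) < k + 1 by positivity)
    have h3 := Real.one_sub_inv_le_log_of_pos (show (0 : ℝ) < k + 2 by positivity)
    have h4 : iota m δ (k + 1) - iota m δ k = Real.log (((k : ℝ) + 3) / (k + 1)) := by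
      rw [iota_eq hm hδ0, iota_eq hm hδ0,
        Real.log_div (show (k : ℝ) + 3 ≠ 0 by positivity) (by positivity)]
      push_cast
      rw [show (k : ℝ) + 1 + 1 = k + 2 by ring, show (k : ℝ) + 1 + 2 = k + 3 by ring]
      ring
    have h5 := Real.log_le_sub_one_of_pos (show (0 : ℝ) < ((k : ℝ) + 3) / (k + 1) by positivity)
    have h6 : ((k : ℝ) + 3) / (k + 1) - 1 = 2 * ((k : ℝ) + 1)⁻¹ := by field_simp; ring
    have h7 : ((k : ℝ) + 2)⁻¹ ≤ ((k : ℝ) + 1)⁻¹ := by gcongr; linarith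
    have h8 : (k : ℝ) * ((k : ℝ) + 1)⁻¹ = 1 - ((k : ℝ) + 1)⁻¹ := by field_simp; ring
    have h9 : (k : ℝ) * (iota m δ (k + 1) - iota m δ k) ≤ k * (2 * ((k : ℝ) + 1)⁻¹) := by
      rw [h4, ← h6]; gcongr
    push_cast
    linarith

lemma bonus_nonneg (hγ1 : γ < 1) (k : ℕ) : 0 ≤ bonus m ε δ γ k := by
  have : 0 < 1 - γ := by linarith
  unfold bonus; positivity

lemma bonus_antitone (hm : 1 ≤ m) (hδ0 : 0 < δ) (hδ1 : δ ≤ 1) (hγ1 : γ < 1)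
    (hH : 0 < paramH ε γ) {i k : ℕ} (hi : 1 ≤ i) (h : i ≤ k) :
    bonus m ε δ γ k ≤ bonus m ε δ γ i := by
  have : 0 < 1 - γ := by linarith
  unfold bonus
  refine mul_le_mul_of_nonneg_left (Real.sqrt_le_sqrt ?_) (by positivity)
  rw [mul_div_assoc, mul_div_assoc]
  exact mul_le_mul_of_nonneg_left (iota_div_antitone hm hδ0 hδ1 hi h) hH.le

lemma bonus_le_mul_inv_sqrt (hm : 1 ≤ m) (hδ0 : 0 < δ) (hγ1 : γ < 1)
    (hH : 0 < paramH ε γ) {i k : ℕ} (hi : 1 ≤ i) (h : i ≤ k) :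
    bonus m ε δ γ i ≤ bonus m ε δ γ k * √(k : ℝ) * (1 / √(i : ℝ)) := by
  have : 0 < 1 - γ := by linarith
  have hi' : (0 : ℝ) < i := by exact_mod_cast hi
  have hk' : (0 : ℝ) < k := by exact_mod_cast hi.trans h
  unfold bonus
  have e : 4 * √2 / (1 - γ) * √(paramH ε γ * iota m δ k / k) * √(k : ℝ) * (1 / √(i : ℝ)) =
      4 * √2 / (1 - γ) * √(paramH ε γ * iota m δ k / i) := by
    rw [Real.sqrt_div' _ hk'.le, Real.sqrt_div' _ hi'.le]
    have := Real.sqrt_pos.2 hk'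
    field_simp
  rw [e]
  refine mul_le_mul_of_nonneg_left (Real.sqrt_le_sqrt ?_) (by positivity)
  exact div_le_div_of_nonneg_right
    (mul_le_mul_of_nonneg_left (iota_mono hm hδ0 h) hH.le) hi'.le

/-- The logarithmic growth of the confidence level is traded for a small additive error:
`log k ≤ log X + k / X`. -/
lemma bonus_le_add (hm : 1 ≤ m) (hδ0 : 0 < δ) (hδ1 : δ ≤ 1) (hγ1 : γ < 1)
    (hH : 0 < paramH ε γ) {X : ℝ} (hX : 1 ≤ X) {k : ℕ} (hk : 1 ≤ k) :
    bonus m ε δ γ k ≤ 4 * √2 / (1 - γ) * √(paramH ε γ * (6 / X)) +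
      4 * √2 / (1 - γ) * √(paramH ε γ * (Real.log (m / δ) + 2 * Real.log X)) *
        (1 / √(k : ℝ)) := by
  have : 0 < 1 - γ := by linarith
  have hk' : (1 : ℝ) ≤ k := by exact_mod_cast hk
  have hX0 : 0 < X := by linarith
  have hm' : (1 : ℝ) ≤ m := by exact_mod_cast hm
  have hA : 0 ≤ Real.log (m / δ) := Real.log_nonneg (by rw [le_div_iff₀ hδ0]; linarith)
  have hlX := Real.log_nonneg hX
  have h1 : Real.log ((k : ℝ) + 2) ≤ Real.log X + 3 * k / X := by
    have h := Real.log_le_sub_one_of_pos (show 0 < ((k : ℝ) + 2) / X by positivity)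
    rw [Real.log_div (by positivity) hX0.ne'] at h
    have : ((k : ℝ) + 2) / X ≤ 3 * k / X := by gcongr; linarith
    linarith
  have h2 : Real.log ((k : ℝ) + 1) ≤ Real.log ((k : ℝ) + 2) :=
    Real.log_le_log (by positivity) (by linarith)
  have h3 : iota m δ k / k ≤ (Real.log (m / δ) + 2 * Real.log X) / k + 6 / X := by
    rw [iota_eq hm hδ0, div_le_iff₀ (by linarith), add_mul, div_mul_cancel₀ _ (by positivity)]
    have : 6 / X * k = 2 * (3 * k / X) := by ring
    linarith
  have h4 : paramH ε γ * iota m δ k / k ≤ paramH ε γ * (6 / X) +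
      paramH ε γ * (Real.log (m / δ) + 2 * Real.log X) / k := by
    rw [mul_div_assoc, mul_div_assoc, ← mul_add, add_comm]
    exact mul_le_mul_of_nonneg_left h3 hH.le
  have h5 := (Real.sqrt_le_sqrt h4).trans (sqrt_add_le (by positivity) (by positivity))
  rw [Real.sqrt_div' (paramH ε γ * (Real.log (m / δ) + 2 * Real.log X))
    (by linarith : (0 : ℝ) ≤ k)] at h5
  unfold bonus
  calc _ ≤ 4 * √2 / (1 - γ) * (√(paramH ε γ * (6 / X)) +
        √(paramH ε γ * (Real.log (m / δ) + 2 * Real.log X)) / √(k : ℝ)) := by gcongr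
    _ = _ := by ring

end Bonus

/-! ### The tables of the algorithm -/

section Tables

variable {S A : Type*} [Fintype S] [Fintype A] [DecidableEq S] [DecidableEq A]
  (M : MDP S A) (ε δ γ : ℝ) (π : Policy S A) (ω : ℕ → S)

/-- The state-action pair at each time. -/
def pairAt {S A : Type*} (π : Policy S A) (ω : ℕ → S) (t : ℕ) : S × A := (ω t, act π ω t)

/-- The value estimate `V̂` at time `t`. -/
noncomputable def vhat (t : ℕ) (s : S) : ℝ := ⨆ a, (memory M ε δ γ π ω t).Qhat s a

/-- The value towards which the update at time `u` moves the table entry. -/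
noncomputable def target (u : ℕ) : ℝ :=
  M.r (ω u) (act π ω u) + bonus (Fintype.card S * Fintype.card A) ε δ γ
    (visits (pairAt π ω) (pairAt π ω u) u + 1) + γ * vhat M ε δ γ π ω u (ω (u + 1))

lemma memory_N (t : ℕ) (s : S) (a : A) :
    (memory M ε δ γ π ω t).N s a = visits (pairAt π ω) (s, a) t := by
  induction t generalizing s a with
  | zero => simp [memory, initMemory, visits_zero]
  | succ t ih =>
    rw [visits_succ]
    simp only [memory, Memory.update, pairAt, Prod.mk.injEq]
    by_cases h : s = ω t ∧ a = act π ω t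
    · rw [if_pos h, if_pos ⟨h.1.symm, h.2.symm⟩, ← h.1, ← h.2, ih]
    · rw [if_neg h, if_neg (fun h' => h ⟨h'.1.symm, h'.2.symm⟩), ih]
      simp

lemma memory_Q_succ_of_ne {t : ℕ} {s : S} {a : A} (h : pairAt π ω t ≠ (s, a)) :
    (memory M ε δ γ π ω (t + 1)).Q s a = (memory M ε δ γ π ω t).Q s a := by
  simp only [memory, Memory.update]
  exact if_neg fun h' => h (by rw [pairAt, h'.1, h'.2])

lemma memory_Qhat_succ_of_ne {t : ℕ} {s : S} {a : A} (h : pairAt π ω t ≠ (s, a)) :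
    (memory M ε δ γ π ω (t + 1)).Qhat s a = (memory M ε δ γ π ω t).Qhat s a := by
  simp only [memory, Memory.update]
  exact if_neg fun h' => h (by rw [pairAt, h'.1, h'.2])

lemma memory_Q_succ_of_eq {t : ℕ} {s : S} {a : A} (h : pairAt π ω t = (s, a)) :
    (memory M ε δ γ π ω (t + 1)).Q s a =
      (1 - rate (paramH ε γ) (visits (pairAt π ω) (s, a) t + 1)) *
        (memory M ε δ γ π ω t).Q s a +
      rate (paramH ε γ) (visits (pairAt π ω) (s, a) t + 1) * target M ε δ γ π ω t := by
  obtain ⟨rfl, rfl⟩ := Prod.mk.inj h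
  have e := memory_N M ε δ γ π ω t (ω t) (act π ω t)
  simp only [memory, Memory.update, and_self, if_true]
  rw [e]
  rfl

lemma memory_Qhat_succ_of_eq {t : ℕ} {s : S} {a : A} (h : pairAt π ω t = (s, a)) :
    (memory M ε δ γ π ω (t + 1)).Qhat s a =
      min ((memory M ε δ γ π ω t).Qhat s a) ((memory M ε δ γ π ω (t + 1)).Q s a) := by
  obtain ⟨rfl, rfl⟩ := Prod.mk.inj h
  simp only [memory, Memory.update, and_self, if_true]

lemma memory_Qhat_succ_le (t : ℕ) (s : S) (a : A) :
    (memory M ε δ γ π ω (t + 1)).Qhat s a ≤ (memory M ε δ γ π ω t).Qhat s a := by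
  by_cases h : pairAt π ω t = (s, a)
  · rw [memory_Qhat_succ_of_eq M ε δ γ π ω h]
    exact min_le_left _ _
  · rw [memory_Qhat_succ_of_ne M ε δ γ π ω h]

lemma memory_Qhat_le (t : ℕ) (s : S) (a : A) :
    (memory M ε δ γ π ω t).Qhat s a ≤ 1 / (1 - γ) := by
  induction t with
  | zero => exact le_rfl
  | succ t ih => exact (memory_Qhat_succ_le M ε δ γ π ω t s a).trans ih

lemma memory_Qhat_le_Q (t : ℕ) (s : S) (a : A) :
    (memory M ε δ γ π ω t).Qhat s a ≤ (memory M ε δ γ π ω t).Q s a := by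
  induction t with
  | zero => exact le_rfl
  | succ t ih =>
    by_cases h : pairAt π ω t = (s, a)
    · rw [memory_Qhat_succ_of_eq M ε δ γ π ω h]
      exact min_le_right _ _
    · rw [memory_Qhat_succ_of_ne M ε δ γ π ω h, memory_Q_succ_of_ne M ε δ γ π ω h]
      exact ih

variable {ε γ}

/-- As the first learning rate is `1`, the table forgets its initial value. -/
lemma memory_Q_eq (hH : 0 < paramH ε γ) {t : ℕ} {s : S} {a : A}
    (h : 0 < visits (pairAt π ω) (s, a) t) :
    (memory M ε δ γ π ω t).Q s a =
      visitAvg (paramH ε γ) (pairAt π ω) (s, a) t (target M ε δ γ π ω) := by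
  induction t with
  | zero => simp [visits_zero] at h
  | succ t ih =>
    by_cases hx : pairAt π ω t = (s, a)
    · rw [memory_Q_succ_of_eq M ε δ γ π ω hx, visitAvg_succ_of_eq hx]
      rcases Nat.eq_zero_or_pos (visits (pairAt π ω) (s, a) t) with h0 | h0
      · rw [h0, zero_add, rate_one hH]; ring
      · rw [ih h0]
    · rw [visits_succ, if_neg hx, add_zero] at h
      rw [memory_Q_succ_of_ne M ε δ γ π ω hx, visitAvg_succ_of_ne hx, ih h]

lemma vhat_succ_le [Nonempty A] (t : ℕ) (s : S) :
    vhat M ε δ γ π ω (t + 1) s ≤ vhat M ε δ γ π ω t s :=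
  ciSup_mono (Set.finite_range _).bddAbove (memory_Qhat_succ_le M ε δ γ π ω t s)

lemma vhat_le [Nonempty A] (t : ℕ) (s : S) : vhat M ε δ γ π ω t s ≤ 1 / (1 - γ) :=
  ciSup_le (memory_Qhat_le M ε δ γ π ω t s)

end Tables

/-! ### Averages of the bonuses -/

section BonusAverages

variable {S A : Type*} [Fintype S] [Fintype A] [DecidableEq S] [DecidableEq A] [Nonempty A]
  {ε δ γ : ℝ} {π : Policy S A} {ω : ℕ → S}

lemma visitAvg_bonus_le (hδ0 : 0 < δ) (hγ1 : γ < 1) (hH : 0 < paramH ε γ)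
    {t : ℕ} {s : S} {a : A} (h : 0 < visits (pairAt π ω) (s, a) t) :
    visitAvg (paramH ε γ) (pairAt π ω) (s, a) t
        (fun u => bonus (Fintype.card S * Fintype.card A) ε δ γ
          (visits (pairAt π ω) (s, a) u + 1)) ≤
      2 * bonus (Fintype.card S * Fintype.card A) ε δ γ (visits (pairAt π ω) (s, a) t) := by
  have hm : 1 ≤ Fintype.card S * Fintype.card A :=
    Nat.mul_pos (Fintype.card_pos_iff.2 ⟨s⟩) Fintype.card_pos
  set k := visits (pairAt π ω) (s, a) t with hk
  have hk0 : 0 < √(k : ℝ) := Real.sqrt_pos.2 (by exact_mod_cast h)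
  refine (visitAvg_mono hH fun u hu hx => bonus_le_mul_inv_sqrt (k := k) hm hδ0 hγ1 hH
    (Nat.le_add_left 1 _) (Nat.succ_le_of_lt (visits_lt hx hu))).trans ?_
  rw [visitAvg_mul]
  refine (mul_le_mul_of_nonneg_left (visitAvg_inv_sqrt_le hH h)
    (mul_nonneg (bonus_nonneg hγ1 _) hk0.le)).trans (le_of_eq ?_)
  rw [← hk]
  field_simp

lemma bonus_le_visitAvg (hδ0 : 0 < δ) (hδ1 : δ ≤ 1) (hγ1 : γ < 1) (hH : 0 < paramH ε γ)
    {t : ℕ} {s : S} {a : A} (h : 0 < visits (pairAt π ω) (s, a) t) :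
    bonus (Fintype.card S * Fintype.card A) ε δ γ (visits (pairAt π ω) (s, a) t) ≤
    visitAvg (paramH ε γ) (pairAt π ω) (s, a) t
        (fun u => bonus (Fintype.card S * Fintype.card A) ε δ γ
          (visits (pairAt π ω) (s, a) u + 1)) := by
  have hm : 1 ≤ Fintype.card S * Fintype.card A :=
    Nat.mul_pos (Fintype.card_pos_iff.2 ⟨s⟩) Fintype.card_pos
  conv_lhs => rw [← visitAvg_const (x := pairAt π ω) hH h (bonus _ _ _ _ _)]
  exact visitAvg_mono hH fun u hu hx => bonus_antitone hm hδ0 hδ1 hγ1 hH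
    (Nat.le_add_left 1 _) (Nat.succ_le_of_lt (visits_lt hx hu))

end BonusAverages

/-! ### Optimism and the sum of the gaps -/

section Optimism

variable {S A : Type*} [Fintype S] [Fintype A] [DecidableEq S] [DecidableEq A] [Nonempty A]
  [MeasurableSpace S] [MeasurableSingletonClass S]
  (M : MDP S A) {ε δ γ : ℝ} (π : Policy S A) (ω : ℕ → S)

/-- The sampling error of the optimal value at time `u`. -/
noncomputable def samplingError (M : MDP S A) (γ : ℝ) (π : Policy S A) (ω : ℕ → S) (u : ℕ) : ℝ :=
  optValue M γ (ω (u + 1)) - M.next (ω u) (act π ω u) (optValue M γ)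

/-- Up to time `T`, the averaged sampling errors are within the bonuses. -/
def WellSampled (M : MDP S A) (ε δ γ : ℝ) (π : Policy S A) (ω : ℕ → S) (T : ℕ) : Prop :=
  ∀ t ≤ T, ∀ s a, 0 < visits (pairAt π ω) (s, a) t →
    |visitAvg (paramH ε γ) (pairAt π ω) (s, a) t (samplingError M γ π ω)| ≤
      bonus (Fintype.card S * Fintype.card A) ε δ γ (visits (pairAt π ω) (s, a) t)

variable {M π ω}

omit [Nonempty A] in
lemma visitAvg_target_eq (hH : 0 < paramH ε γ) {t : ℕ} {s : S} {a : A}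
    (h : 0 < visits (pairAt π ω) (s, a) t) :
    visitAvg (paramH ε γ) (pairAt π ω) (s, a) t (target M ε δ γ π ω) =
      optQ M γ s a + visitAvg (paramH ε γ) (pairAt π ω) (s, a) t
        (fun u => bonus (Fintype.card S * Fintype.card A) ε δ γ
          (visits (pairAt π ω) (s, a) u + 1)) +
      γ * visitAvg (paramH ε γ) (pairAt π ω) (s, a) t
        (fun u => vhat M ε δ γ π ω u (ω (u + 1)) - optValue M γ (ω (u + 1))) +
      γ * visitAvg (paramH ε γ) (pairAt π ω) (s, a) t (samplingError M γ π ω) := by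
  rw [← visitAvg_const (x := pairAt π ω) (t := t) hH h (optQ M γ s a), ← visitAvg_mul,
    ← visitAvg_mul, ← visitAvg_add, ← visitAvg_add, ← visitAvg_add]
  refine Finset.sum_congr rfl fun u _ => ?_
  split_ifs with hx
  · obtain ⟨rfl, rfl⟩ := Prod.mk.inj hx
    congr 1
    simp only [target, optQ, samplingError, pairAt]
    ring
  · rfl

variable (hδ0 : 0 < δ) (hδ1 : δ ≤ 1) (hγ0 : 0 ≤ γ) (hγ1 : γ < 1) (hH : 0 < paramH ε γ)
include hδ0 hδ1 hγ0 hγ1 hH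

/-- Optimism: the tables stay above the optimal action values. -/
lemma optQ_le_Qhat {T : ℕ} (hT : WellSampled M ε δ γ π ω T) {t : ℕ} (ht : t ≤ T) (s : S) (a : A) :
    optQ M γ s a ≤ (memory M ε δ γ π ω t).Qhat s a := by
  induction t using Nat.strong_induction_on generalizing s a with
  | _ t ih =>
    rcases t with _ | t
    · exact (optQ_le_optValue M hγ0 hγ1 s a).trans (optValue_le M hγ0 hγ1 s)
    by_cases hx : pairAt π ω t = (s, a)
    · rw [memory_Qhat_succ_of_eq M ε δ γ π ω hx]
      refine le_min (ih t (Nat.lt_succ_self t) (by omega) s a) ?_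
      have hv : 0 < visits (pairAt π ω) (s, a) (t + 1) := by
        rw [visits_succ, if_pos hx]; omega
      rw [memory_Q_eq M δ π ω hH hv, visitAvg_target_eq hH hv]
      have h1 := bonus_le_visitAvg (π := π) (ω := ω) hδ0 hδ1 hγ1 hH hv
      have h2 : 0 ≤ visitAvg (paramH ε γ) (pairAt π ω) (s, a) (t + 1)
          (fun u => vhat M ε δ γ π ω u (ω (u + 1)) - optValue M γ (ω (u + 1))) := by
        have := visitAvg_mono (H := paramH ε γ) (x := pairAt π ω) (z := (s, a)) (t := t + 1)
          (y := fun _ => 0)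
          (y' := fun u => vhat M ε δ γ π ω u (ω (u + 1)) - optValue M γ (ω (u + 1))) hH ?_
        · simpa [visitAvg] using this
        · intro u hu _
          rw [sub_nonneg, optValue_eq M hγ0 hγ1]
          exact ciSup_mono (Set.finite_range _).bddAbove fun b => ih u hu (by omega) _ b
      have h3 := (abs_le.1 (hT (t + 1) ht s a hv)).1
      have h4 := bonus_nonneg (m := Fintype.card S * Fintype.card A) (ε := ε) (δ := δ) hγ1
        (visits (pairAt π ω) (s, a) (t + 1))
      nlinarith [mul_nonneg hγ0 h2, mul_le_mul_of_nonneg_left h3 hγ0,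
        mul_nonneg (sub_nonneg.2 hγ1.le) h4]
    · rw [memory_Qhat_succ_of_ne M ε δ γ π ω hx]
      exact ih t (Nat.lt_succ_self t) (by omega) s a

lemma optValue_le_vhat {T : ℕ} (hT : WellSampled M ε δ γ π ω T) {t : ℕ} (ht : t ≤ T) (s : S) :
    optValue M γ s ≤ vhat M ε δ γ π ω t s := by
  rw [optValue_eq M hγ0 hγ1]
  exact ciSup_mono (Set.finite_range _).bddAbove fun b =>
    optQ_le_Qhat hδ0 hδ1 hγ0 hγ1 hH hT ht s b

omit hδ1 in
lemma Qhat_sub_optQ_le {T : ℕ} (hT : WellSampled M ε δ γ π ω T) {t : ℕ} (ht : t ≤ T) {s : S} {a : A}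
    (hv : 0 < visits (pairAt π ω) (s, a) t) :
    (memory M ε δ γ π ω t).Qhat s a - optQ M γ s a ≤
      3 * bonus (Fintype.card S * Fintype.card A) ε δ γ (visits (pairAt π ω) (s, a) t) +
      γ * visitAvg (paramH ε γ) (pairAt π ω) (s, a) t
        (fun u => vhat M ε δ γ π ω u (ω (u + 1)) - optValue M γ (ω (u + 1))) := by
  have h0 := memory_Qhat_le_Q M ε δ γ π ω t s a
  rw [memory_Q_eq M δ π ω hH hv, visitAvg_target_eq hH hv] at h0
  have h1 := visitAvg_bonus_le (π := π) (ω := ω) hδ0 hγ1 hH hv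
  have h3 := (abs_le.1 (hT t ht s a hv)).2
  have h4 := bonus_nonneg (m := Fintype.card S * Fintype.card A) (ε := ε) (δ := δ) hγ1
    (visits (pairAt π ω) (s, a) t)
  nlinarith [mul_le_mul_of_nonneg_left h3 hγ0, mul_nonneg (sub_nonneg.2 hγ1.le) h4]

/-- The weighted sum of the suboptimality gaps `V^*(s_t) - Q^*(s_t, a_t)` of the actions taken. -/
theorem sum_weighted_gap_le {E F θ : ℝ} (hHγ : γ * (1 + 1 / paramH ε γ) ≤ (1 + γ) / 2)
    (hE : 0 ≤ E) (hF : 0 ≤ F) (hθ : 0 < θ)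
    (hb : ∀ k : ℕ, 1 ≤ k → 3 * bonus (Fintype.card S * Fintype.card A) ε δ γ k ≤
      E + F * (1 / √(k : ℝ)))
    (hgreedy : ∀ t, ∀ a, (memory M ε δ γ π ω t).Qhat (ω t) a ≤
      (memory M ε δ γ π ω t).Qhat (ω t) (act π ω t))
    {T : ℕ} (hT : WellSampled M ε δ γ π ω T) (w : ℕ → ℝ) (W : ℝ) (hw0 : ∀ t, 0 ≤ w t)
    (hwW : ∀ t, w t ≤ W) :
    ∑ t ∈ Finset.range T, w t * (optValue M γ (ω t) - optQ M γ (ω t) (act π ω t)) ≤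
      2 / (1 - γ) * ((Fintype.card S * Fintype.card A : ℕ) * (2 * (1 / (1 - γ)) + 2 * F / θ)) * W +
        (E + F * θ) / (1 - γ) * ∑ t ∈ Finset.range T, w t := by
  have hg : 0 < 1 - γ := by linarith
  set φ : ℕ → ℝ := fun t =>
    (memory M ε δ γ π ω t).Qhat (ω t) (act π ω t) - optQ M γ (ω t) (act π ω t) with hφdef
  set ψ : ℕ → ℝ := fun u => vhat M ε δ γ π ω u (ω (u + 1)) - optValue M γ (ω (u + 1)) with hψdef
  -- The update at time `u` reads `V̂` before the table changes, whereas `φ (u + 1)` refers to the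
  -- table after the change; `d u` bounds the difference, and its sum over `u` telescopes.
  set d : ℕ → ℝ := fun u => ∑ s, (vhat M ε δ γ π ω u s - vhat M ε δ γ π ω (u + 1) s) with hddef
  have hvq : ∀ t, vhat M ε δ γ π ω t (ω t) =
      (memory M ε δ γ π ω t).Qhat (ω t) (act π ω t) := fun t =>
    le_antisymm (ciSup_le (hgreedy t)) (le_ciSup
      (f := fun a => (memory M ε δ γ π ω t).Qhat (ω t) a) (Set.finite_range _).bddAbove _)
  have hd0' : ∀ u s, 0 ≤ vhat M ε δ γ π ω u s - vhat M ε δ γ π ω (u + 1) s := fun u s =>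
    sub_nonneg.2 (vhat_succ_le M δ π ω u s)
  have hgap : ∑ t ∈ Finset.range T,
      w t * (optValue M γ (ω t) - optQ M γ (ω t) (act π ω t)) ≤
      ∑ t ∈ Finset.range T, w t * φ t := by
    refine Finset.sum_le_sum fun t ht => mul_le_mul_of_nonneg_left ?_ (hw0 t)
    simp only [hφdef]
    rw [← hvq]
    exact sub_le_sub_right (optValue_le_vhat hδ0 hδ1 hγ0 hγ1 hH hT (Finset.mem_range.1 ht).le _) _
  refine hgap.trans ?_
  have hd : ∑ u ∈ Finset.range T, d u ≤ Fintype.card (S × A) * (1 / (1 - γ)) := by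
    simp only [hddef]
    rw [Finset.sum_comm]
    have h1 : ∀ s : S, ∑ u ∈ Finset.range T,
        (vhat M ε δ γ π ω u s - vhat M ε δ γ π ω (u + 1) s) ≤ 1 / (1 - γ) := by
      intro s
      rw [Finset.sum_range_sub']
      have := vhat_le M (ε := ε) (γ := γ) δ π ω 0 s
      have h2 := (optValue_nonneg M hγ0 hγ1 s).trans
        (optValue_le_vhat hδ0 hδ1 hγ0 hγ1 hH hT le_rfl s)
      linarith
    refine (Finset.sum_le_sum fun s _ => h1 s).trans ?_
    rw [Finset.sum_const, nsmul_eq_mul, Finset.card_univ]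
    refine mul_le_mul_of_nonneg_right ?_ (by positivity)
    rw [Fintype.card_prod]
    exact_mod_cast Nat.le_mul_of_pos_right _ Fintype.card_pos
  have key := sum_weighted_error_le (Z := S × A) (B := 1 / (1 - γ)) hH hγ0 hγ1 hHγ (by positivity)
    hE hF hθ (pairAt π ω) φ ψ d T ?_ ?_ ?_ (fun u => Finset.sum_nonneg fun s _ => hd0' u s) hd
    w W hw0 hwW
  · rwa [Fintype.card_prod] at key
  · intro t _
    have h1 := memory_Qhat_le M ε δ γ π ω t (ω t) (act π ω t)
    have h2 := optQ_nonneg M hγ0 hγ1 (ω t) (act π ω t)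
    simp only [hφdef]
    linarith
  · intro t ht hv
    exact (Qhat_sub_optQ_le hδ0 hγ0 hγ1 hH hT ht.le hv).trans (add_le_add (hb _ hv) le_rfl)
  · intro u hu
    have h1 : vhat M ε δ γ π ω u (ω (u + 1)) - vhat M ε δ γ π ω (u + 1) (ω (u + 1)) ≤ d u :=
      Finset.single_le_sum (f := fun s => vhat M ε δ γ π ω u s - vhat M ε δ γ π ω (u + 1) s)
        (fun s _ => hd0' u s) (Finset.mem_univ _)
    have h2 := optQ_le_optValue M hγ0 hγ1 (ω (u + 1)) (act π ω (u + 1))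
    have h3 := hvq (u + 1)
    simp only [hφdef, hψdef]
    linarith

end Optimism

/-! ### Probability of large sampling errors -/

section SamplingErrors

lemma visits_congr {Z : Type*} [DecidableEq Z] {x x' : ℕ → Z} (z : Z) {t : ℕ}
    (h : ∀ u < t, x u = x' u) : visits x z t = visits x' z t := by
  induction t with
  | zero => simp [visits_zero]
  | succ t ih =>
    rw [visits_succ, visits_succ, ih fun u hu => h u (hu.trans t.lt_succ_self),
      h t t.lt_succ_self]

lemma rate_le {H : ℝ} (hH : 1 ≤ H) {k : ℕ} (hk : 1 ≤ k) : rate H k ≤ 2 * H / k := by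
  have hk' : (1 : ℝ) ≤ k := by exact_mod_cast hk
  unfold rate
  rw [div_le_div_iff₀ (by linarith) (by linarith)]
  nlinarith

lemma sum_range_inv_mul_le (T : ℕ) :
    ∑ j ∈ Finset.range T, 1 / (((j : ℝ) + 2) * (j + 3)) ≤ 1 / 2 := by
  have key : ∑ j ∈ Finset.range T, 1 / (((j : ℝ) + 2) * (j + 3)) = 1 / 2 - 1 / (T + 2) := by
    induction T with
    | zero => simp
    | succ T ih =>
      rw [Finset.sum_range_succ, ih]
      push_cast
      field_simp
      ring
  rw [key]
  have : (0 : ℝ) ≤ 1 / (T + 2) := by positivity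
  linarith

variable {S A : Type*} [Fintype S] [Fintype A] [DecidableEq S] [DecidableEq A] [Nonempty A]
  [MeasurableSpace S] [MeasurableSingletonClass S] (M : MDP S A) {ε δ γ : ℝ} (π : Policy S A)

/-- The sum, over the visits to `(s, a)` before time `T`, of the weights that they keep after `k`
visits times the negative sampling errors. -/
noncomputable def noiseSum (M : MDP S A) (ε γ : ℝ) (π : Policy S A) (T : ℕ) (s : S) (a : A)
    (k : ℕ) (ω : ℕ → S) : ℝ :=
  ∑ t ∈ Finset.range T, (if pairAt π ω t = (s, a) then
    keptWeight (paramH ε γ) (visits (pairAt π ω) (s, a) t + 1) k else 0) *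
    (M.next (ω t) (act π ω t) (optValue M γ) - optValue M γ (ω (t + 1)))

omit [Fintype A] [Nonempty A] in
lemma noiseSum_visits_eq (ω : ℕ → S) {T t : ℕ} (ht : t ≤ T) (s : S) (a : A) :
    noiseSum M ε γ π T s a (visits (pairAt π ω) (s, a) t) ω =
      -visitAvg (paramH ε γ) (pairAt π ω) (s, a) t (samplingError M γ π ω) := by
  rw [visitAvg_eq_sum_range _ ht, noiseSum, ← Finset.sum_neg_distrib]
  refine Finset.sum_congr rfl fun u _ => ?_
  rw [samplingError]
  split_ifs <;> ring

/-- A Chernoff bound for one state-action pair, one visit count and one sign `σ`. -/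
lemma measure_noiseSum_gt_le (hδ0 : 0 < δ) (hδ1 : δ ≤ 1) (hγ0 : 0 ≤ γ) (hγ1 : γ < 1)
    (hH : 1 ≤ paramH ε γ) (s₁ : S) (T : ℕ) (s : S) (a : A) {k : ℕ} (hk : 1 ≤ k)
    {σ : ℝ} (hσ : σ ^ 2 = 1) :
    trajLaw M π s₁ {ω | bonus (Fintype.card S * Fintype.card A) ε δ γ k <
        σ * noiseSum M ε γ π T s a k ω} ≤
      ENNReal.ofReal (Real.exp (-(2 * iota (Fintype.card S * Fintype.card A) δ k))) := by
  have hm : 1 ≤ Fintype.card S * Fintype.card A :=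
    Nat.mul_pos (Fintype.card_pos_iff.2 ⟨s⟩) Fintype.card_pos
  have hg : 0 < 1 - γ := by linarith
  have hH0 : 0 < paramH ε γ := by linarith
  have hk' : (0 : ℝ) < k := by exact_mod_cast hk
  set H := paramH ε γ with hHdef
  set m := Fintype.card S * Fintype.card A with hmdef
  have hι := iota_nonneg hm hδ0 hδ1 k
  set ι := iota m δ k with hιdef
  -- The exponent `κ` balances the two terms of the exponential bound up to constants.
  set κ : ℝ := (1 - γ) * √(ι * k / H) with hκ
  have hκ2 : κ ^ 2 = (1 - γ) ^ 2 * (ι * k / H) := by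
    rw [hκ, mul_pow, Real.sq_sqrt (by positivity)]
  have hκb : κ * bonus m ε δ γ k = 4 * √2 * ι := by
    rw [hκ, bonus, ← hHdef, ← hιdef]
    have : √(ι * k / H) * √(H * ι / k) = ι := by
      rw [← Real.sqrt_mul (by positivity)]
      have : ι * k / H * (H * ι / k) = ι ^ 2 := by field_simp
      rw [this, Real.sqrt_sq hι]
    calc _ = 4 * √2 * ((1 - γ) / (1 - γ)) * (√(ι * k / H) * √(H * ι / k)) := by ring
      _ = _ := by rw [this, div_self hg.ne']; ring
  refine le_trans (measure_mono fun ω hω => ?_)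
    (measure_weighted_deviation_le M π s₁
      (fun t ω => if pairAt π ω t = (s, a) then
        keptWeight H (visits (pairAt π ω) (s, a) t + 1) k else 0)
      (fun _ _ => optValue M γ) (1 / (1 - γ)) ?_ (fun _ _ _ _ => rfl)
      (fun _ _ x => ⟨optValue_nonneg M hγ0 hγ1 x, optValue_le M hγ0 hγ1 x⟩) (σ * κ) (2 * ι) T)
  · change bonus m ε δ γ k < σ * noiseSum M ε γ π T s a k ω at hω
    change 2 * ι ≤ σ * κ * noiseSum M ε γ π T s a k ω - _
    have h1 : ∑ t ∈ Finset.range T, (if pairAt π ω t = (s, a) then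
        keptWeight H (visits (pairAt π ω) (s, a) t + 1) k else 0) ^ 2 ≤ 2 * H / k := by
      have e : ∀ t, (if pairAt π ω t = (s, a) then
        keptWeight H (visits (pairAt π ω) (s, a) t + 1) k else 0) ^ 2 =
        if pairAt π ω t = (s, a) then
        keptWeight H (visits (pairAt π ω) (s, a) t + 1) k ^ 2 else 0 := fun t => by
        split_ifs <;> simp
      simp_rw [e]
      rw [sum_of_visits_eq (pairAt π ω) (s, a) (fun n => keptWeight H (n + 1) k ^ 2)]
      obtain ⟨j, rfl⟩ : ∃ j, k = j + 1 := ⟨k - 1, by omega⟩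
      refine le_trans ?_ ((sum_keptWeight_sq_le hH0 j).trans (rate_le hH hk))
      set n := visits (pairAt π ω) (s, a) T
      calc _ ≤ ∑ i ∈ Finset.range (max n (j + 1)), keptWeight H (i + 1) (j + 1) ^ 2 :=
            Finset.sum_le_sum_of_subset_of_nonneg (Finset.range_mono (le_max_left _ _))
              fun _ _ _ => sq_nonneg _
        _ = _ := by
            symm
            refine Finset.sum_subset (Finset.range_mono (le_max_right _ _)) fun i _ hi => ?_
            have : j + 1 ≤ i := by simpa using hi
            rw [keptWeight_of_lt (by omega)]
            norm_num
    have h2 := mul_le_mul_of_nonneg_left hω.le (show 0 ≤ κ by positivity)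
    have h3 : (σ * κ) ^ 2 * (1 / (1 - γ)) ^ 2 / 8 * (2 * H / k) = ι / 4 := by
      rw [mul_pow, hσ, hκ2]
      field_simp
      ring
    have h4 := mul_le_mul_of_nonneg_left h1
      (show 0 ≤ (σ * κ) ^ 2 * (1 / (1 - γ)) ^ 2 / 8 by positivity)
    have h5 : (1 : ℝ) ≤ √2 := Real.one_le_sqrt.2 (by norm_num)
    rw [hκb] at h2
    nlinarith
  · intro t ω ω' h
    have hx : ∀ u ≤ t, pairAt π ω u = pairAt π ω' u := fun u hu => by
      unfold pairAt
      rw [h u hu, act_congr π fun i hi => h i (hi.trans hu)]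
    rw [hx t le_rfl, visits_congr _ fun u hu => hx u (le_of_lt hu)]

/-- With probability at least `1 - δ / 2` the bonuses dominate the sampling errors. -/
lemma measure_not_wellSampled_le (hδ0 : 0 < δ) (hδ1 : δ ≤ 1) (hγ0 : 0 ≤ γ) (hγ1 : γ < 1)
    (hH : 1 ≤ paramH ε γ) (s₁ : S) (T : ℕ) :
    trajLaw M π s₁ {ω | ¬ WellSampled M ε δ γ π ω T} ≤ ENNReal.ofReal (δ / 2) := by
  have hm : 1 ≤ Fintype.card S * Fintype.card A :=
    Nat.mul_pos (Fintype.card_pos_iff.2 ⟨s₁⟩) Fintype.card_pos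
  set m := Fintype.card S * Fintype.card A with hmdef
  have hm' : (1 : ℝ) ≤ m := by exact_mod_cast hm
  set bad : ℝ → S × A → ℕ → Set (ℕ → S) := fun σ z j =>
    {ω | bonus m ε δ γ (j + 1) < σ * noiseSum M ε γ π T z.1 z.2 (j + 1) ω} with hbad
  have hsub : {ω | ¬ WellSampled M ε δ γ π ω T} ⊆
      ⋃ z ∈ (Finset.univ : Finset (S × A)), ⋃ j ∈ Finset.range T, bad 1 z j ∪ bad (-1) z j := by
    intro ω hω
    have hω' : ¬ WellSampled M ε δ γ π ω T := hω
    unfold WellSampled at hω'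
    push Not at hω'
    obtain ⟨t, ht, s, a, hv, hlt⟩ := hω'
    obtain ⟨j, hj⟩ : ∃ j, visits (pairAt π ω) (s, a) t = j + 1 :=
      ⟨visits (pairAt π ω) (s, a) t - 1, by omega⟩
    have hjT : j < T := by
      have := visits_le (pairAt π ω) (s, a) t
      omega
    simp only [Set.mem_iUnion, Finset.mem_range, Finset.mem_univ]
    refine ⟨(s, a), trivial, j, hjT, ?_⟩
    have hn := noiseSum_visits_eq (ε := ε) (γ := γ) M π ω ht s a
    rw [hj] at hn hlt
    rcases lt_abs.1 hlt with h | h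
    · right
      simp only [hbad, Set.mem_ofPred_eq]
      rw [hn]
      linarith
    · left
      simp only [hbad, Set.mem_ofPred_eq]
      rw [hn]
      linarith
  have hone : ∀ z j, trajLaw M π s₁ (bad 1 z j ∪ bad (-1) z j) ≤
      ENNReal.ofReal (δ / m * (1 / (((j : ℝ) + 2) * (j + 3)))) := by
    intro z j
    have h1 := measure_noiseSum_gt_le (ε := ε) M π hδ0 hδ1 hγ0 hγ1 hH s₁ T z.1 z.2
      (Nat.le_add_left 1 j) (σ := 1) (by norm_num)
    have h2 := measure_noiseSum_gt_le (ε := ε) M π hδ0 hδ1 hγ0 hγ1 hH s₁ T z.1 z.2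
      (Nat.le_add_left 1 j) (σ := -1) (by norm_num)
    refine (measure_union_le _ _).trans ((add_le_add h1 h2).trans ?_)
    rw [← ENNReal.ofReal_add (Real.exp_nonneg _) (Real.exp_nonneg _)]
    refine ENNReal.ofReal_le_ofReal ?_
    have he : Real.exp (-iota m δ (j + 1)) = δ / m * (1 / (((j : ℝ) + 2) * (j + 3))) := by
      unfold iota
      rw [Real.exp_neg, Real.exp_log (by positivity)]
      push_cast
      rw [inv_div]
      field_simp
      ring
    rw [show -(2 * iota m δ (j + 1)) = -iota m δ (j + 1) + -iota m δ (j + 1) by ring,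
      Real.exp_add, he]
    set p := δ / m * (1 / (((j : ℝ) + 2) * (j + 3))) with hp
    have hp0 : 0 ≤ p := by positivity
    have hp1 : p ≤ 1 / 2 := by
      have a1 : δ / m ≤ 1 := by rw [div_le_one (by linarith)]; linarith
      have a2 : 1 / (((j : ℝ) + 2) * (j + 3)) ≤ 1 / 2 := by
        refine one_div_le_one_div_of_le two_pos ?_
        nlinarith [Nat.cast_nonneg (α := ℝ) j]
      calc p ≤ 1 * (1 / 2) := by
            rw [hp]
            exact mul_le_mul a1 a2 (by positivity) zero_le_one
        _ = 1 / 2 := one_mul _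
    -- Both signs together have probability at most `2 p ^ 2 ≤ p`.
    nlinarith
  refine (measure_mono hsub).trans ((measure_biUnion_finset_le _ _).trans ?_)
  calc _ ≤ ∑ _z : S × A, ENNReal.ofReal (δ / m * (1 / 2)) := by
        refine Finset.sum_le_sum fun z _ => (measure_biUnion_finset_le _ _).trans ?_
        refine (Finset.sum_le_sum fun j _ => hone z j).trans ?_
        rw [← ENNReal.ofReal_sum_of_nonneg fun j _ => by positivity]
        refine ENNReal.ofReal_le_ofReal ?_
        rw [← Finset.mul_sum]
        exact mul_le_mul_of_nonneg_left (sum_range_inv_mul_le T) (by positivity)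
    _ = ENNReal.ofReal (δ / 2) := by
        rw [Finset.sum_const, Finset.card_univ, Fintype.card_prod, nsmul_eq_mul, ← hmdef,
          ← ENNReal.ofReal_natCast, ← ENNReal.ofReal_mul (by positivity)]
        congr 1
        field_simp

end SamplingErrors

/-! ### Losses at the bad times -/

section BadTimes

/-- The discounted number of marked times before `t`. -/
def discountedCount (γ : ℝ) (b : ℕ → ℝ) : ℕ → ℝ
  | 0 => 0
  | t + 1 => γ * (discountedCount γ b t + b t)

variable {γ : ℝ} {b : ℕ → ℝ}

lemma discountedCount_nonneg (hγ0 : 0 ≤ γ) (hb : ∀ t, 0 ≤ b t) (t : ℕ) :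
    0 ≤ discountedCount γ b t := by
  induction t with
  | zero => exact le_rfl
  | succ t ih => exact mul_nonneg hγ0 (add_nonneg ih (hb t))

lemma discountedCount_add_le (hγ0 : 0 ≤ γ) (hγ1 : γ < 1) (hb : ∀ t, b t ≤ 1) (t : ℕ) :
    discountedCount γ b t + b t ≤ 1 / (1 - γ) := by
  have hg : 0 < 1 - γ := by linarith
  have e : γ * (1 / (1 - γ)) + 1 = 1 / (1 - γ) := by field_simp; ring
  induction t with
  | zero =>
    have : 0 ≤ γ * (1 / (1 - γ)) := by positivity
    have := hb 0
    simp only [discountedCount]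
    linarith
  | succ t ih =>
    have h1 := mul_le_mul_of_nonneg_left ih hγ0
    have h2 := hb (t + 1)
    simp only [discountedCount]
    linarith

lemma sum_discountedCount_add (T : ℕ) :
    (1 - γ) * ∑ t ∈ Finset.range T, (discountedCount γ b t + b t) + discountedCount γ b T =
      ∑ t ∈ Finset.range T, b t := by
  induction T with
  | zero => simp [discountedCount]
  | succ T ih =>
    rw [Finset.sum_range_succ, Finset.sum_range_succ, ← ih, discountedCount]
    ring

/-- Summation of a discounted recursion, started anew at every marked time. -/
lemma sum_mul_eq_of_recursion {G c : ℕ → ℝ} (hG : ∀ t, G t = c t + γ * G (t + 1)) (T : ℕ) :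
    ∑ t ∈ Finset.range T, b t * G t =
      ∑ t ∈ Finset.range T, (discountedCount γ b t + b t) * c t + discountedCount γ b T * G T := by
  induction T with
  | zero => simp [discountedCount]
  | succ T ih =>
    rw [Finset.sum_range_succ, Finset.sum_range_succ, ih, discountedCount, hG T]
    ring

variable {S A : Type*} [Fintype S] [MeasurableSpace S] [MeasurableSingletonClass S]

open Classical in
/-- The indicator of the times at which the policy followed from then on is not `ε`-optimal. -/
noncomputable def badTime (M : MDP S A) (γ ε : ℝ) (π : Policy S A) (ω : ℕ → S) (t : ℕ) : ℝ :=
  if value M γ (after π (past ω t)) (ω t) < optValue M γ (ω t) - ε then 1 else 0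

variable (M : MDP S A) {ε : ℝ} (π : Policy S A)

lemma badTime_nonneg (ω : ℕ → S) (t : ℕ) : 0 ≤ badTime M γ ε π ω t := by
  unfold badTime; split_ifs <;> norm_num

lemma badTime_le_one (ω : ℕ → S) (t : ℕ) : badTime M γ ε π ω t ≤ 1 := by
  unfold badTime; split_ifs <;> norm_num

lemma badTime_congr {ω ω' : ℕ → S} {t : ℕ} (h : ∀ i ≤ t, ω i = ω' i) :
    badTime M γ ε π ω t = badTime M γ ε π ω' t := by
  unfold badTime
  rw [past_congr fun i hi => h i hi.le, h t le_rfl]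

lemma discountedCount_badTime_congr {ω ω' : ℕ → S} {t : ℕ} (h : ∀ i ≤ t, ω i = ω' i) :
    discountedCount γ (badTime M γ ε π ω) t = discountedCount γ (badTime M γ ε π ω') t := by
  induction t with
  | zero => simp only [discountedCount]
  | succ t ih =>
    have e1 := ih fun i hi => h i (hi.trans t.le_succ)
    have e2 : badTime M γ ε π ω t = badTime M γ ε π ω' t :=
      badTime_congr M π fun i hi => h i (hi.trans t.le_succ)
    simp only [discountedCount]
    rw [e1, e2]

/-- The loss of the continuation from time `t + 1` on, in the state `x`. -/
noncomputable def nextLoss (M : MDP S A) (γ : ℝ) (π : Policy S A) (t : ℕ) (ω : ℕ → S) (x : S) : ℝ :=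
  optValue M γ x - value M γ (after π (past ω (t + 1))) x

/-- The weight of the time `t` in the sum of the losses over the bad times. -/
noncomputable def lossWeight (M : MDP S A) (γ ε : ℝ) (π : Policy S A) (t : ℕ) (ω : ℕ → S) : ℝ :=
  discountedCount γ (badTime M γ ε π ω) t + badTime M γ ε π ω t

/-- The difference between the conditional expectation of the next loss and the next loss. -/
noncomputable def lossDeviation (M : MDP S A) (γ : ℝ) (π : Policy S A) (t : ℕ) (ω : ℕ → S) : ℝ :=
  M.next (ω t) (act π ω t) (nextLoss M γ π t ω) - nextLoss M γ π t ω (ω (t + 1))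

lemma nextLoss_mem [Nonempty A] (hγ0 : 0 ≤ γ) (hγ1 : γ < 1) (t : ℕ) (ω : ℕ → S) (x : S) :
    nextLoss M γ π t ω x ∈ Set.Icc 0 (1 / (1 - γ)) := by
  have h1 := value_le_optValue M hγ0 hγ1 (after π (past ω (t + 1))) x
  have h2 := value_nonneg M hγ0 hγ1 (after π (past ω (t + 1))) x
  have h3 := optValue_le M hγ0 hγ1 x
  unfold nextLoss
  exact ⟨by linarith, by linarith⟩

/-- The losses accumulated at the bad times are the gaps of the actions taken, with the weights
`lossWeight`, up to a martingale and a bounded remainder. -/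
lemma mul_sum_badTime_le [Nonempty A] (hγ0 : 0 ≤ γ) (hγ1 : γ < 1) (ω : ℕ → S)
    (T : ℕ) :
    ε * ∑ t ∈ Finset.range T, badTime M γ ε π ω t ≤
      ∑ t ∈ Finset.range T, lossWeight M γ ε π t ω *
        (optValue M γ (ω t) - optQ M γ (ω t) (act π ω t)) +
      γ * ∑ t ∈ Finset.range T, lossWeight M γ ε π t ω * lossDeviation M γ π t ω +
      1 / (1 - γ) ^ 2 := by
  have hg : 0 < 1 - γ := by linarith
  set G : ℕ → ℝ := fun t => optValue M γ (ω t) - value M γ (after π (past ω t)) (ω t) with hG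
  have hrec : ∀ t, G t = (optValue M γ (ω t) - optQ M γ (ω t) (act π ω t) +
      γ * lossDeviation M γ π t ω) + γ * G (t + 1) := by
    intro t
    simp only [hG, lossDeviation]
    rw [value_after_past M hγ0 hγ1, optQ]
    have : M.next (ω t) (act π ω t) (nextLoss M γ π t ω) =
        M.next (ω t) (act π ω t) (optValue M γ) -
        M.next (ω t) (act π ω t) (value M γ (after π (past ω (t + 1)))) := M.next_sub _ _ _ _
    rw [this, nextLoss]
    ring
  have h1 := sum_mul_eq_of_recursion (b := badTime M γ ε π ω) hrec T
  have h2 : ε * ∑ t ∈ Finset.range T, badTime M γ ε π ω t ≤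
      ∑ t ∈ Finset.range T, badTime M γ ε π ω t * G t := by
    rw [Finset.mul_sum]
    refine Finset.sum_le_sum fun t _ => ?_
    unfold badTime
    split_ifs with h
    · simp only [hG]; linarith
    · simp
  have h3 : discountedCount γ (badTime M γ ε π ω) T * G T ≤ 1 / (1 - γ) ^ 2 := by
    have a1 := discountedCount_add_le hγ0 hγ1 (badTime_le_one (γ := γ) (ε := ε) M π ω) T
    have a2 := badTime_nonneg (γ := γ) (ε := ε) M π ω T
    have a3 : G T ≤ 1 / (1 - γ) := by
      have := value_nonneg M hγ0 hγ1 (after π (past ω T)) (ω T)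
      have := optValue_le M hγ0 hγ1 (ω T)
      simp only [hG]
      linarith
    have a4 : 0 ≤ G T := sub_nonneg.2 (value_le_optValue M hγ0 hγ1 _ _)
    calc _ ≤ 1 / (1 - γ) * (1 / (1 - γ)) :=
          mul_le_mul (by linarith) a3 a4 (by positivity)
      _ = _ := by rw [div_mul_div_comm, one_mul, sq]
  rw [h1] at h2
  have h4 : ∑ t ∈ Finset.range T, (discountedCount γ (badTime M γ ε π ω) t + badTime M γ ε π ω t) *
      (optValue M γ (ω t) - optQ M γ (ω t) (act π ω t) + γ * lossDeviation M γ π t ω) =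
      ∑ t ∈ Finset.range T, lossWeight M γ ε π t ω *
        (optValue M γ (ω t) - optQ M γ (ω t) (act π ω t)) +
      γ * ∑ t ∈ Finset.range T, lossWeight M γ ε π t ω * lossDeviation M γ π t ω := by
    rw [Finset.mul_sum, ← Finset.sum_add_distrib]
    refine Finset.sum_congr rfl fun t _ => ?_
    rw [lossWeight]
    ring
  rw [h4] at h2
  linarith

lemma sum_lossWeight_le (hγ0 : 0 ≤ γ) (hγ1 : γ < 1) (ω : ℕ → S) (T : ℕ) :
    ∑ t ∈ Finset.range T, lossWeight M γ ε π t ω ≤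
      (∑ t ∈ Finset.range T, badTime M γ ε π ω t) / (1 - γ) := by
  have hg : 0 < 1 - γ := by linarith
  rw [le_div_iff₀ hg]
  have h1 := sum_discountedCount_add (γ := γ) (b := badTime M γ ε π ω) T
  have h2 := discountedCount_nonneg hγ0 (badTime_nonneg (γ := γ) (ε := ε) M π ω) T
  unfold lossWeight
  linarith

/-- The losses are predicted by their conditional expectations, up to a deviation of order
`√n / (1 - γ) ^ 2` over `n` bad times; this is linearized with a multiple of `ε`. -/
lemma measure_lossDeviation_le [Nonempty A] (hγ0 : 0 ≤ γ) (hγ1 : γ < 1) (hε : 0 < ε) {δ : ℝ}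
    (hδ0 : 0 < δ) (s₁ : S) (T : ℕ) :
    trajLaw M π s₁ {ω | Real.log (2 / δ) / (2 * ε * (1 - γ) ^ 4) +
        ε / 4 * ∑ t ∈ Finset.range T, badTime M γ ε π ω t ≤
        ∑ t ∈ Finset.range T, lossWeight M γ ε π t ω * lossDeviation M γ π t ω} ≤
      ENNReal.ofReal (δ / 2) := by
  have hg : 0 < 1 - γ := by linarith
  set lam : ℝ := 2 * ε * (1 - γ) ^ 4 with hlam
  have hlam0 : 0 < lam := by positivity
  have h := measure_weighted_deviation_le M π s₁ (lossWeight M γ ε π) (nextLoss M γ π)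
    (1 / (1 - γ)) (fun t ω ω' h => by
      unfold lossWeight
      rw [discountedCount_badTime_congr M π h, badTime_congr M π h])
    (fun t ω ω' h => by
      funext x
      unfold nextLoss
      rw [past_congr fun i hi => h i (Nat.lt_succ_iff.1 hi)])
    (nextLoss_mem M π hγ0 hγ1) lam (Real.log (2 / δ)) T
  rw [← Real.log_inv, Real.exp_log (by positivity), inv_div] at h
  refine le_trans (measure_mono fun ω hω => ?_) h
  have hω' : Real.log (2 / δ) / lam + ε / 4 * ∑ t ∈ Finset.range T, badTime M γ ε π ω t ≤
    ∑ t ∈ Finset.range T, lossWeight M γ ε π t ω * lossDeviation M γ π t ω := hω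
  change Real.log (2 / δ) ≤ lam * ∑ t ∈ Finset.range T,
    lossWeight M γ ε π t ω * lossDeviation M γ π t ω - _
  set n := ∑ t ∈ Finset.range T, badTime M γ ε π ω t with hn
  have hw0 : ∀ t, 0 ≤ lossWeight M γ ε π t ω := fun t =>
    add_nonneg (discountedCount_nonneg hγ0 (badTime_nonneg M π ω) t) (badTime_nonneg M π ω t)
  have hw1 : ∀ t, lossWeight M γ ε π t ω ≤ 1 / (1 - γ) := fun t =>
    discountedCount_add_le hγ0 hγ1 (badTime_le_one M π ω) t
  have hsum := sum_lossWeight_le (ε := ε) M π hγ0 hγ1 ω T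
  have hsq : ∑ t ∈ Finset.range T, lossWeight M γ ε π t ω ^ 2 ≤ 1 / (1 - γ) * (n / (1 - γ)) := by
    refine le_trans ?_ (mul_le_mul_of_nonneg_left hsum (by positivity))
    rw [Finset.mul_sum]
    refine Finset.sum_le_sum fun t _ => ?_
    rw [sq]
    exact mul_le_mul_of_nonneg_right (hw1 t) (hw0 t)
  have h1 := mul_le_mul_of_nonneg_left hω' hlam0.le
  have h2 := mul_le_mul_of_nonneg_left hsq
    (show 0 ≤ lam ^ 2 * (1 / (1 - γ)) ^ 2 / 8 by positivity)
  have h3 : lam ^ 2 * (1 / (1 - γ)) ^ 2 / 8 * (1 / (1 - γ) * (n / (1 - γ))) =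
      lam * (ε / 4 * n) := by
    rw [hlam]
    field_simp
    ring
  have h4 : lam * (Real.log (2 / δ) / lam) = Real.log (2 / δ) := by field_simp
  rw [mul_add, h4] at h1
  linarith

/-- A bound on the number of bad times before every finite time bounds their total number. -/
lemma sampleComplexity_le {N : ℝ} {ω : ℕ → S}
    (h : ∀ T, ∑ t ∈ Finset.range T, badTime M γ ε π ω t ≤ N) :
    (sampleComplexity M γ ε π ω : ℝ≥0∞) ≤ ENNReal.ofReal N := by
  have hN : 0 ≤ N := by simpa using h 0
  have h1 : sampleComplexity M γ ε π ω ≤ (⌊N⌋₊ : ℕ∞) := by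
    by_contra hlt
    push Not at hlt
    have hle : ((⌊N⌋₊ + 1 : ℕ) : ℕ∞) ≤ sampleComplexity M γ ε π ω := by
      push_cast
      exact Order.add_one_le_of_lt hlt
    obtain ⟨s, hs, hcard⟩ := Set.exists_subset_encard_eq hle
    have hfin : s.Finite := Set.finite_of_encard_eq_coe hcard
    obtain ⟨T, hT⟩ := hfin.bddAbove
    have h2 : ((⌊N⌋₊ + 1 : ℕ) : ℝ) ≤ ∑ t ∈ Finset.range (T + 1), badTime M γ ε π ω t := by
      have hc : hfin.toFinset.card = ⌊N⌋₊ + 1 := by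
        rw [hfin.encard_eq_coe_toFinset_card] at hcard
        exact_mod_cast hcard
      calc ((⌊N⌋₊ + 1 : ℕ) : ℝ) = ∑ t ∈ hfin.toFinset, badTime M γ ε π ω t := by
            rw [← hc, Finset.card_eq_sum_ones, Nat.cast_sum]
            refine Finset.sum_congr rfl fun t ht => ?_
            have : value M γ (after π (past ω t)) (ω t) < optValue M γ (ω t) - ε :=
              hs (hfin.mem_toFinset.1 ht)
            rw [badTime, if_pos this, Nat.cast_one]
        _ ≤ _ := by
            refine Finset.sum_le_sum_of_subset_of_nonneg (fun t ht => ?_)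
              fun t _ _ => badTime_nonneg M π ω t
            exact Finset.mem_range.2 (Nat.lt_succ_of_le (hT (hfin.mem_toFinset.1 ht)))
    have h3 := Nat.lt_floor_add_one N
    have h4 := h (T + 1)
    push_cast at h2
    linarith
  calc (sampleComplexity M γ ε π ω : ℝ≥0∞) ≤ ((⌊N⌋₊ : ℕ∞) : ℝ≥0∞) :=
        ENat.toENNReal_le.2 h1
    _ = ENNReal.ofReal (⌊N⌋₊ : ℝ) := by simp
    _ ≤ ENNReal.ofReal N := ENNReal.ofReal_le_ofReal (Nat.floor_le hN)

end BadTimes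

/-! ### The high-probability bound -/

section HighProbability

variable {S A : Type*} [Fintype S] [Fintype A] [DecidableEq S] [DecidableEq A]
  [MeasurableSpace S] [MeasurableSingletonClass S]

/-- The sample complexity in terms of an error bound `E + F / √n` for the bonuses, whose additive
part is small compared with `ε`. -/
theorem le_measure_sampleComplexity_le [Nonempty A] (M : MDP S A) {ε δ γ : ℝ} (π : Policy S A)
    (hπ : IsUCBQLearning M ε δ γ π)
    (hε : 0 < ε) (hδ0 : 0 < δ) (hδ1 : δ ≤ 1) (hγ0 : 0 ≤ γ) (hγ1 : γ < 1)
    (hH : 1 ≤ paramH ε γ) (hHγ : γ * (1 + 1 / paramH ε γ) ≤ (1 + γ) / 2)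
    {E F θ N : ℝ} (hE : 0 ≤ E) (hF : 0 ≤ F) (hθ : 0 < θ)
    (hb : ∀ k : ℕ, 1 ≤ k → 3 * bonus (Fintype.card S * Fintype.card A) ε δ γ k ≤
      E + F * (1 / √(k : ℝ)))
    (hEF : E + F * θ ≤ ε * (1 - γ) ^ 2 / 4)
    (hN : 2 / ε * (2 / (1 - γ) ^ 2 * ((Fintype.card S * Fintype.card A : ℕ) *
      (2 * (1 / (1 - γ)) + 2 * F / θ)) + Real.log (2 / δ) / (2 * ε * (1 - γ) ^ 4) +
      1 / (1 - γ) ^ 2) ≤ N) (s₁ : S) :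
    ENNReal.ofReal (1 - δ) ≤ trajLaw M π s₁
      {ω | (sampleComplexity M γ ε π ω : ℝ≥0∞) ≤ ENNReal.ofReal N} := by
  have hg : 0 < 1 - γ := by linarith
  set good : ℕ → Set (ℕ → S) := fun T =>
    {ω | ∑ t ∈ Finset.range T, badTime M γ ε π ω t ≤ N} with hgood
  have hmeas : ∀ T, MeasurableSet (good T) := by
    intro T
    refine measurableSet_le (measurable_of_agree T _ fun ω ω' h => ?_) measurable_const
    refine Finset.sum_congr rfl fun t ht => ?_
    exact badTime_congr M π fun i hi => h i (hi.trans (Finset.mem_range.1 ht).le)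
  have hanti : Antitone good := by
    intro T T' hT ω hω
    have hω' : ∑ t ∈ Finset.range T', badTime M γ ε π ω t ≤ N := hω
    refine (?_ : ∑ t ∈ Finset.range T, badTime M γ ε π ω t ≤ N)
    refine le_trans ?_ hω'
    exact Finset.sum_le_sum_of_subset_of_nonneg (Finset.range_mono hT)
      fun t _ _ => badTime_nonneg M π ω t
  have hT : ∀ T, ENNReal.ofReal (1 - δ) ≤ trajLaw M π s₁ (good T) := by
    intro T
    have hc : trajLaw M π s₁ (good T)ᶜ ≤ ENNReal.ofReal δ := by
      have hsub : (good T)ᶜ ⊆ {ω | ¬ WellSampled M ε δ γ π ω T} ∪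
          {ω | Real.log (2 / δ) / (2 * ε * (1 - γ) ^ 4) +
            ε / 4 * ∑ t ∈ Finset.range T, badTime M γ ε π ω t ≤
            ∑ t ∈ Finset.range T, lossWeight M γ ε π t ω * lossDeviation M γ π t ω} := by
        intro ω hω
        by_contra hcon
        rw [Set.mem_union, not_or] at hcon
        have hws : WellSampled M ε δ γ π ω T := not_not.1 hcon.1
        have hdev := hcon.2
        rw [Set.mem_ofPred_eq, not_le] at hdev
        refine hω ?_
        change ∑ t ∈ Finset.range T, badTime M γ ε π ω t ≤ N
        have h1 := mul_sum_badTime_le (ε := ε) M π hγ0 hγ1 ω T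
        have h2 := sum_weighted_gap_le hδ0 hδ1 hγ0 hγ1 (by linarith) hHγ hE hF hθ hb (hπ ω) hws
          (fun t => lossWeight M γ ε π t ω) (1 / (1 - γ))
          (fun t => add_nonneg (discountedCount_nonneg hγ0 (badTime_nonneg M π ω) t)
            (badTime_nonneg M π ω t))
          (fun t => discountedCount_add_le hγ0 hγ1 (badTime_le_one M π ω) t)
        have h3 := sum_lossWeight_le (ε := ε) M π hγ0 hγ1 ω T
        set n := ∑ t ∈ Finset.range T, badTime M γ ε π ω t with hn
        have hn0 : 0 ≤ n := Finset.sum_nonneg fun t _ => badTime_nonneg M π ω t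
        have h4 : (E + F * θ) / (1 - γ) * ∑ t ∈ Finset.range T, lossWeight M γ ε π t ω ≤
            ε / 4 * n := by
          calc _ ≤ (ε * (1 - γ) ^ 2 / 4) / (1 - γ) * (n / (1 - γ)) :=
                mul_le_mul (div_le_div_of_nonneg_right hEF hg.le) h3
                  (Finset.sum_nonneg fun t _ =>
                    add_nonneg (discountedCount_nonneg hγ0 (badTime_nonneg M π ω) t)
                      (badTime_nonneg M π ω t)) (by positivity)
            _ = ε / 4 * n := by field_simp
        have hL : 0 ≤ Real.log (2 / δ) / (2 * ε * (1 - γ) ^ 4) := by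
          refine div_nonneg (Real.log_nonneg ?_) (by positivity)
          rw [le_div_iff₀ hδ0]
          linarith
        have h5 : γ * ∑ t ∈ Finset.range T, lossWeight M γ ε π t ω * lossDeviation M γ π t ω ≤
            Real.log (2 / δ) / (2 * ε * (1 - γ) ^ 4) + ε / 4 * n := by
          have a1 := mul_le_mul_of_nonneg_left hdev.le hγ0
          have a2 : 0 ≤ ε / 4 * n := by positivity
          have a3 := mul_le_of_le_one_left (add_nonneg hL a2) hγ1.le
          exact a1.trans a3
        have h6 : 2 / (1 - γ) * ((Fintype.card S * Fintype.card A : ℕ) *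
            (2 * (1 / (1 - γ)) + 2 * F / θ)) * (1 / (1 - γ)) =
            2 / (1 - γ) ^ 2 * ((Fintype.card S * Fintype.card A : ℕ) *
            (2 * (1 / (1 - γ)) + 2 * F / θ)) := by
          field_simp
        rw [h6] at h2
        refine le_trans ?_ hN
        rw [div_mul_eq_mul_div, le_div_iff₀ hε]
        linarith
      refine (measure_mono hsub).trans ((measure_union_le _ _).trans ?_)
      refine (add_le_add (measure_not_wellSampled_le M π hδ0 hδ1 hγ0 hγ1 hH s₁ T)
        (measure_lossDeviation_le M π hγ0 hγ1 hε hδ0 s₁ T)).trans (le_of_eq ?_)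
      rw [← ENNReal.ofReal_add (by positivity) (by positivity), add_halves]
    have h1 := prob_add_prob_compl (μ := trajLaw M π s₁) (hmeas T)
    rw [ENNReal.ofReal_sub 1 hδ0.le, ENNReal.ofReal_one, tsub_le_iff_right, ← h1]
    exact add_le_add le_rfl hc
  have hinter : ENNReal.ofReal (1 - δ) ≤ trajLaw M π s₁ (⋂ T, good T) := by
    rw [hanti.measure_iInter (fun T => (hmeas T).nullMeasurableSet) ⟨0, measure_ne_top _ _⟩]
    exact le_iInf hT
  refine hinter.trans (measure_mono fun ω hω => ?_)
  exact sampleComplexity_le M π fun T => Set.mem_iInter.1 hω T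

end HighProbability

/-! ### Size of the parameters -/

section ParameterBounds

variable {ε γ : ℝ}

/-- All parameters are polynomially bounded in `max 1 (1 / ε) / (1 - γ)`. -/
lemma log_inv_paramEps1_mem (hε : 0 < ε) (hγ : 1 / 2 < γ) (hγ1 : γ < 1) (hεγ : ε * (1 - γ) < 1) :
    Real.log (1 / ((1 - γ) * paramEps1 ε γ)) ∈
      Set.Icc 2 (23 * Real.log (max 1 (1 / ε) / (1 - γ))) := by
  have hg : 0 < 1 - γ := by linarith
  have hg2 : 1 - γ < 1 / 2 := by linarith
  have hlog2 : 1 / 2 < Real.log 2 := by linarith [Real.log_two_gt_d9]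
  set g := 1 - γ with hgdef
  set z : ℝ := max 1 (1 / ε) / g with hz
  set u : ℝ := 1 / (ε * g) with hu
  have hu1 : 1 < u := by rw [hu, lt_div_iff₀ (by positivity)]; linarith
  have huz : u ≤ z := by
    rw [hu, hz, ← div_div]
    exact div_le_div_of_nonneg_right (le_max_right _ _) hg.le
  have hgz : 1 / g ≤ z := div_le_div_of_nonneg_right (le_max_left _ _) hg.le
  have hg2' : 2 < 1 / g := by rw [lt_div_iff₀ hg]; linarith
  have hz2 : 2 ≤ z := hg2'.le.trans hgz
  have hz0 : 0 < z := by linarith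
  set l := Real.log (1 / g) with hl
  have hl2 : 1 / 2 < l := hlog2.trans (Real.log_lt_log two_pos hg2')
  have hlz : l ≤ z := ((Real.log_le_sub_one_of_pos (by positivity)).trans (by linarith)).trans hgz
  -- The number of steps `R`.
  set R : ℝ := (paramR ε γ : ℝ) with hR
  have h3u : Real.log (3 / (ε * (1 - γ))) = Real.log (3 * u) := by rw [hu, mul_one_div]
  have hx1 : 1 < Real.log (3 * u) := by
    rw [Real.lt_log_iff_exp_lt (by positivity)]
    linarith [Real.exp_one_lt_d9]
  have hxle : Real.log (3 * u) / g ≤ 3 * z ^ 2 := by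
    have h1 : Real.log (3 * u) ≤ 3 * z :=
      (Real.log_le_sub_one_of_pos (by positivity)).trans (by linarith)
    calc Real.log (3 * u) / g = Real.log (3 * u) * (1 / g) := by ring
      _ ≤ 3 * z * z := mul_le_mul h1 hgz (by positivity) (by positivity)
      _ = 3 * z ^ 2 := by ring
  have hRlow : 2 < R := by
    have h1 : Real.log (3 * u) / g ≤ R := by
      rw [hR, paramR, h3u]
      exact Nat.le_ceil _
    have h2 : 1 / g < Real.log (3 * u) / g := div_lt_div_of_pos_right hx1 hg
    linarith
  have hRup : R ≤ 4 * z ^ 2 := by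
    have h1 : R < Real.log (3 * u) / g + 1 := by
      rw [hR, paramR, h3u]
      exact Nat.ceil_lt_add_one (by positivity)
    nlinarith
  -- The accuracy `ξ_L`.
  set Y : ℝ := 1 / (paramXi ε γ (Nat.log 2 (paramR ε γ)) * (1 - γ)) with hY
  have hYeq : Y = 12 * 2 ^ Nat.log 2 (paramR ε γ) * l * u := by
    rw [hY, paramXi, ← hgdef, ← hl, hu, pow_add]
    field_simp
    norm_num
  have hpow : (2 : ℝ) ^ Nat.log 2 (paramR ε γ) ≤ R := by
    have : paramR ε γ ≠ 0 := by
      intro h0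
      rw [hR, h0] at hRlow
      norm_num at hRlow
    rw [hR]
    exact_mod_cast Nat.pow_log_le_self 2 this
  have hY0 : 0 < Y := by rw [hYeq]; positivity
  have hYup : Y ≤ 48 * z ^ 4 := by
    rw [hYeq]
    calc 12 * 2 ^ Nat.log 2 (paramR ε γ) * l * u ≤ 12 * (4 * z ^ 2) * z * z := by
          gcongr
          exact hpow.trans hRup
      _ = 48 * z ^ 4 := by ring
  -- The number `M` of levels.
  set m : ℝ := (paramM ε γ : ℝ) with hm
  have hmlow : 10 ≤ m := by
    rw [hm]
    exact_mod_cast le_max_right _ 10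
  have hmup : m ≤ 203 * z ^ 4 := by
    have h1 : 2 * Real.logb 2 Y ≤ 4 * Y := by
      have h2 : Real.logb 2 Y ≤ 2 * Y := by
        rw [Real.logb, div_le_iff₀ (by linarith)]
        have h3 := Real.log_le_sub_one_of_pos hY0
        nlinarith
      linarith
    have h2 : m ≤ 4 * Y + 11 := by
      rw [hm, paramM, Nat.cast_max]
      refine max_le ?_ (by norm_num; linarith)
      have h4 : ((⌈2 * Real.logb 2 Y⌉₊ : ℕ) : ℝ) ≤ (⌈4 * Y⌉₊ : ℕ) := by
        exact_mod_cast Nat.ceil_mono h1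
      have h5 := Nat.ceil_lt_add_one (show 0 ≤ 4 * Y by positivity)
      linarith
    have h3 : 1 ≤ z ^ 4 := one_le_pow₀ (by linarith)
    linarith
  have heq : 1 / (g * paramEps1 ε γ) = 24 * R * m * l * u := by
    rw [paramEps1, ← hgdef, ← hl, ← hR, ← hm, hu]
    field_simp
  rw [heq]
  have hup : 24 * R * m * l * u ≤ z ^ 23 := by
    calc 24 * R * m * l * u ≤ 24 * (4 * z ^ 2) * (203 * z ^ 4) * z * z := by gcongr
      _ = 19488 * z ^ 8 := by ring
      _ ≤ 2 ^ 15 * z ^ 8 := by gcongr; norm_num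
      _ ≤ z ^ 15 * z ^ 8 := by gcongr
      _ = z ^ 23 := by ring
  have hlow : 240 ≤ 24 * R * m * l * u := by
    calc (240 : ℝ) = 24 * 2 * 10 * (1 / 2) * 1 := by norm_num
      _ ≤ 24 * R * m * l * u := by gcongr
  constructor
  · rw [Real.le_log_iff_exp_le (by linarith)]
    have h1 : Real.exp 2 = Real.exp 1 * Real.exp 1 := by rw [← Real.exp_add]; norm_num
    have h2 := Real.exp_one_lt_d9
    have h3 := Real.exp_pos 1
    nlinarith
  · have := Real.log_le_log (by linarith) hup
    rw [Real.log_pow] at this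
    exact_mod_cast this

lemma paramH_bounds (hε : 0 < ε) (hγ : 1 / 2 < γ) (hγ1 : γ < 1) (hεγ : ε * (1 - γ) < 1) :
    1 ≤ paramH ε γ ∧ γ * (1 + 1 / paramH ε γ) ≤ (1 + γ) / 2 ∧
      paramH ε γ ≤ 23 * Real.log (max 1 (1 / ε) / (1 - γ)) / (1 - γ) := by
  have hg : 0 < 1 - γ := by linarith
  have hγ0 : 0 < γ := by linarith
  obtain ⟨h1, h2⟩ := log_inv_paramEps1_mem hε hγ hγ1 hεγ
  have h3 := Real.log_le_sub_one_of_pos (show 0 < 1 / γ by positivity)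
  have h4 := Real.one_sub_inv_le_log_of_pos (show 0 < 1 / γ by positivity)
  have h5 : 1 / γ - 1 = (1 - γ) / γ := by field_simp
  rw [one_div, inv_inv] at h4
  rw [h5] at h3
  rw [one_div] at h3
  have hl : 0 < Real.log (1 / γ) := by rw [one_div]; linarith
  have hlow : 2 * γ / (1 - γ) ≤ paramH ε γ := by
    rw [paramH, div_le_div_iff₀ hg hl, one_div γ]
    calc 2 * γ * Real.log γ⁻¹ ≤ 2 * γ * ((1 - γ) / γ) := by gcongr
      _ = 2 * (1 - γ) := by field_simp
      _ ≤ _ := by gcongr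
  have hH1 : 1 ≤ paramH ε γ := by
    refine le_trans ?_ hlow
    rw [le_div_iff₀ hg]
    linarith
  refine ⟨hH1, ?_, ?_⟩
  · have : 1 / paramH ε γ ≤ (1 - γ) / (2 * γ) := by
      rw [div_le_div_iff₀ (by linarith) (by linarith)]
      rw [div_le_iff₀ hg] at hlow
      linarith
    have h6 := mul_le_mul_of_nonneg_left this hγ0.le
    have h7 : γ * ((1 - γ) / (2 * γ)) = (1 - γ) / 2 := by field_simp
    rw [mul_add, mul_one]
    linarith
  · rw [paramH, one_div γ]
    exact div_le_div₀ (by linarith) h2 hg h4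

lemma log_max_one_div (hε : 0 < ε) (hγ1 : γ < 1) :
    Real.log (max 1 (1 / ε) / (1 - γ)) = max 0 (Real.log (1 / ε)) + Real.log (1 / (1 - γ)) := by
  have hg : 0 < 1 - γ := by linarith
  rw [Real.log_div (by positivity) hg.ne', one_div (1 - γ), Real.log_inv, ← sub_eq_add_neg]
  congr 1
  rcases le_total 1 (1 / ε) with h | h
  · rw [max_eq_right h, max_eq_right (Real.log_nonneg h)]
  · rw [max_eq_left h, Real.log_one, max_eq_left (Real.log_nonpos (by positivity) h)]

end ParameterBounds

/-- The terms of the final bound, collected into the leading one. -/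
lemma error_terms_le {m D ℓ ε g H K L : ℝ} (hm : 1 ≤ m) (hD : 1 ≤ D) (hℓ : 1 ≤ ℓ) (hε : 0 < ε)
    (hg : 0 < g) (hg1 : g ≤ 1) (hεg : ε * g ≤ 1) (hH : H ≤ 23 * ℓ / g) (hK0 : 0 ≤ K)
    (hK : K ≤ 61 * (ℓ * D)) (hL : L ≤ 2 * D) :
    2 / ε * (2 / g ^ 2 * (m * (2 * (1 / g) + 4608 * (H * K) / (ε * g ^ 4))) +
      L / (2 * ε * g ^ 4) + 1 / g ^ 2) ≤
    30000000 * ℓ ^ 2 * (m * D / (ε ^ 2 * g ^ 7)) := by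
  set Q : ℝ := 1 / (ε ^ 2 * g ^ 7) with hQ
  have hQ0 : 0 < Q := by positivity
  have e : 2 / ε * (2 / g ^ 2 * (m * (2 * (1 / g) + 4608 * (H * K) / (ε * g ^ 4))) +
      L / (2 * ε * g ^ 4) + 1 / g ^ 2) =
      (8 * m * (ε * g ^ 4) + 18432 * m * (H * K * g) + L * g ^ 3 + 2 * (ε * g ^ 5)) * Q := by
    rw [hQ]
    field_simp
    ring
  have e2 : 30000000 * ℓ ^ 2 * (m * D / (ε ^ 2 * g ^ 7)) = 30000000 * ℓ ^ 2 * (m * D) * Q := by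
    rw [hQ]; ring
  rw [e, e2]
  refine mul_le_mul_of_nonneg_right ?_ hQ0.le
  have a1 : ε * g ^ 4 ≤ 1 := by
    calc ε * g ^ 4 = ε * g * g ^ 3 := by ring
      _ ≤ 1 := mul_le_one₀ hεg (by positivity) (pow_le_one₀ hg.le hg1)
  have a2 : ε * g ^ 5 ≤ 1 := by
    calc ε * g ^ 5 = ε * g * g ^ 4 := by ring
      _ ≤ 1 := mul_le_one₀ hεg (by positivity) (pow_le_one₀ hg.le hg1)
  have a3 : H * K * g ≤ 1403 * (ℓ ^ 2 * D) := by
    have : H * g ≤ 23 * ℓ := by rwa [le_div_iff₀ hg] at hH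
    calc H * K * g = H * g * K := by ring
      _ ≤ 23 * ℓ * (61 * (ℓ * D)) := mul_le_mul this hK hK0 (by positivity)
      _ = 1403 * (ℓ ^ 2 * D) := by ring
  have a4 : L * g ^ 3 ≤ 2 * D := by
    calc L * g ^ 3 ≤ 2 * D * g ^ 3 := by gcongr
      _ ≤ 2 * D := mul_le_of_le_one_right (by positivity) (pow_le_one₀ hg.le hg1)
  have hℓ2 : 1 ≤ ℓ ^ 2 := one_le_pow₀ hℓ
  have b1 : m ≤ ℓ ^ 2 * (m * D) := by
    calc m = 1 * (m * 1) := by ring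
      _ ≤ ℓ ^ 2 * (m * D) := by gcongr
  have b2 : D ≤ ℓ ^ 2 * (m * D) := by
    calc D = 1 * (1 * D) := by ring
      _ ≤ ℓ ^ 2 * (m * D) := by gcongr
  have b3 : 1 ≤ ℓ ^ 2 * (m * D) := hm.trans b1
  have c1 : 8 * m * (ε * g ^ 4) ≤ 8 * m := mul_le_of_le_one_right (by positivity) a1
  have c2 : 18432 * m * (H * K * g) ≤ 18432 * m * (1403 * (ℓ ^ 2 * D)) :=
    mul_le_mul_of_nonneg_left a3 (by positivity)
  have c3 : 18432 * m * (1403 * (ℓ ^ 2 * D)) = 25860096 * (ℓ ^ 2 * (m * D)) := by ring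
  linarith

end UCBQ

open UCBQ in
/-- With probability at least `1 - δ`, the sample complexity of exploration of Infinite Q-learning
with UCB is `Õ(S A ln(1/δ) / (ε² (1 - γ)⁷))`: the constant `C` and the degree `k` of the
polylogarithmic factor in `1/ε`, `1/(1-γ)`, `S A` are absolute. -/
theorem theorem1 :
    ∃ (C : ℝ) (k : ℕ), 0 < C ∧
      ∀ (S A : Type*) [Fintype S] [Fintype A] [DecidableEq S] [DecidableEq A]
        [MeasurableSpace S] [MeasurableSingletonClass S]
        (M : UCBQ.MDP S A) (ε δ γ : ℝ), 0 < ε → 0 < δ → 1 / 2 < γ → γ < 1 →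
      ∀ (π : UCBQ.Policy S A), UCBQ.IsUCBQLearning M ε δ γ π →
      ∀ s₁ : S,
        ENNReal.ofReal (1 - δ) ≤
          UCBQ.trajLaw M π s₁
            {ω | (UCBQ.sampleComplexity M γ ε π ω : ℝ≥0∞) ≤
              ENNReal.ofReal
                (C * (1 + Real.log (Fintype.card S * Fintype.card A) + max 0 (Real.log (1 / ε))
                    + Real.log (1 / (1 - γ))) ^ k
                  * (Fintype.card S * Fintype.card A * max 1 (Real.log (1 / δ))
                    / (ε ^ 2 * (1 - γ) ^ 7)))} := by
  refine ⟨30000000, 2, by norm_num, ?_⟩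
  intro S A _ _ _ _ _ _ M ε δ γ hε hδ0 hγ hγ1 π hπ s₁
  have : Nonempty A := ⟨π [] s₁⟩
  have hγ0 : 0 ≤ γ := by linarith
  have hg : 0 < 1 - γ := by linarith
  rcases le_or_gt 1 δ with hδ1 | hδ1
  · rw [ENNReal.ofReal_of_nonpos (by linarith)]
    exact zero_le
  rcases le_or_gt 1 (ε * (1 - γ)) with hεγ | hεγ
  · -- The values lie in `[0, 1 / (1 - γ)]`, so that no time is counted.
    have hbad : ∀ ω t, badTime M γ ε π ω t = 0 := fun ω t => by
      have h1 := value_nonneg M hγ0 hγ1 (after π (past ω t)) (ω t)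
      have h2 := optValue_le M hγ0 hγ1 (ω t)
      have h3 : 1 / (1 - γ) ≤ ε := by rw [div_le_iff₀ hg]; exact hεγ
      exact if_neg (by linarith)
    have hall : ∀ ω, (sampleComplexity M γ ε π ω : ℝ≥0∞) ≤ ENNReal.ofReal 0 := fun ω =>
      sampleComplexity_le M π fun T => by simp [hbad]
    calc ENNReal.ofReal (1 - δ) ≤ 1 := ENNReal.ofReal_le_one.2 (by linarith)
      _ = trajLaw M π s₁ Set.univ := measure_univ.symm
      _ ≤ _ := measure_mono fun ω _ => (hall ω).trans (by simp)
  obtain ⟨hH1, hHγ, hHup⟩ := paramH_bounds hε hγ hγ1 hεγ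
  set m : ℕ := Fintype.card S * Fintype.card A with hmdef
  have hm1 : 1 ≤ m := Nat.mul_pos (Fintype.card_pos_iff.2 ⟨s₁⟩) Fintype.card_pos
  have hm1' : (1 : ℝ) ≤ m := by exact_mod_cast hm1
  set g := 1 - γ with hgdef
  set H := paramH ε γ with hHdef
  set z := max 1 (1 / ε) / g with hz
  have hgz : 1 / g ≤ z := div_le_div_of_nonneg_right (le_max_left _ _) hg.le
  have huz : 1 / (ε * g) ≤ z := by
    rw [hz, ← div_div]
    exact div_le_div_of_nonneg_right (le_max_right _ _) hg.le
  have hz2 : 2 ≤ z := by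
    refine le_trans ?_ hgz
    rw [le_div_iff₀ hg]
    linarith
  have hlz : 0 < Real.log z := Real.log_pos (by linarith)
  have hH0 : 0 < H := by linarith
  -- With this `X` the additive part of the bonuses is `ε (1 - γ) ^ 2 / 8`.
  set X : ℝ := 110592 * H / (ε ^ 2 * g ^ 6) with hX
  have hg1 : g ≤ 1 := by linarith
  have hX1 : 1 < X := by
    rw [hX, lt_div_iff₀ (by positivity), one_mul]
    have : ε ^ 2 * g ^ 6 ≤ 1 := by
      calc ε ^ 2 * g ^ 6 = (ε * g) ^ 2 * g ^ 4 := by ring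
        _ ≤ 1 := mul_le_one₀ (pow_le_one₀ (by positivity) hεγ.le) (by positivity)
            (pow_le_one₀ hg.le hg1)
    linarith
  have hlX : 0 < Real.log X := Real.log_pos hX1
  have hXup : Real.log X ≤ 30 * Real.log z := by
    have h1 : X ≤ z ^ 30 := by
      have h2 : H ≤ 32 * z * z := by
        have h3 : Real.log z ≤ z := (Real.log_le_sub_one_of_pos (by linarith)).trans (by linarith)
        calc H ≤ 23 * Real.log z * (1 / g) := by rw [mul_one_div]; exact hHup
          _ ≤ 32 * z * z := by gcongr; norm_num
      calc X = 110592 * H * (1 / (ε * g)) ^ 2 * (1 / g) ^ 4 := by rw [hX]; field_simp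
        _ ≤ 2 ^ 17 * (32 * z * z) * z ^ 2 * z ^ 4 := by gcongr; norm_num
        _ = 2 ^ 22 * z ^ 8 := by ring
        _ ≤ z ^ 22 * z ^ 8 := by gcongr
        _ = z ^ 30 := by ring
    have := Real.log_le_log (by linarith) h1
    rw [Real.log_pow] at this
    exact_mod_cast this
  set K : ℝ := Real.log (m / δ) + 2 * Real.log X with hK
  have hlm : 0 ≤ Real.log (m / δ) := Real.log_nonneg (by rw [le_div_iff₀ hδ0]; linarith)
  have hK0 : 0 < K := by linarith
  set E : ℝ := 3 * (4 * √2 / g * √(H * (6 / X))) with hE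
  have hEeq : E = ε * g ^ 2 / 8 := by
    have h1 : √2 * √(H * (6 / X)) = ε * g ^ 3 / 96 := by
      rw [← Real.sqrt_mul (by norm_num)]
      have : 2 * (H * (6 / X)) = (ε * g ^ 3 / 96) ^ 2 := by
        rw [hX]; field_simp; norm_num
      rw [this, Real.sqrt_sq (by positivity)]
    calc E = 12 / g * (√2 * √(H * (6 / X))) := by rw [hE]; ring
      _ = ε * g ^ 2 / 8 := by rw [h1]; field_simp; norm_num
  set F : ℝ := 3 * (4 * √2 / g * √(H * K)) with hF
  have hF0 : 0 < F := by positivity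
  have hF2 : F ^ 2 = 288 * (H * K) / g ^ 2 := by
    rw [hF, mul_pow, mul_pow, div_pow, mul_pow, Real.sq_sqrt (by norm_num),
      Real.sq_sqrt (by positivity)]
    ring
  set θ : ℝ := ε * g ^ 2 / (8 * F) with hθ
  have hθ0 : 0 < θ := by positivity
  have hFθ : F * θ = ε * g ^ 2 / 8 := by rw [hθ]; field_simp
  have h2Fθ : 2 * F / θ = 4608 * (H * K) / (ε * g ^ 4) := by
    have : 2 * F / θ = 16 * F ^ 2 / (ε * g ^ 2) := by rw [hθ]; field_simp; norm_num
    rw [this, hF2]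
    field_simp
    norm_num
  set ℓ : ℝ := 1 + Real.log (Fintype.card S * Fintype.card A) + max 0 (Real.log (1 / ε)) +
    Real.log (1 / g) with hℓ
  set D : ℝ := max 1 (Real.log (1 / δ)) with hD
  have hcast : (m : ℝ) = Fintype.card S * Fintype.card A := by rw [hmdef]; push_cast; rfl
  have hℓz : ℓ = 1 + Real.log m + Real.log z := by
    rw [hℓ, hcast, hz, hgdef, log_max_one_div hε hγ1]
    ring
  have hlogm : 0 ≤ Real.log m := Real.log_nonneg hm1'
  have hD1 : 1 ≤ D := le_max_left _ _
  have hDδ : Real.log (1 / δ) ≤ D := le_max_right _ _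
  have hℓ1 : 1 ≤ ℓ := by linarith
  have hKup : K ≤ 61 * (ℓ * D) := by
    have h1 : Real.log (m / δ) = Real.log m + Real.log (1 / δ) := by
      rw [← Real.log_mul (by positivity) (by positivity), mul_one_div]
    have h2 : ℓ ≤ ℓ * D := le_mul_of_one_le_right (by linarith) hD1
    have h3 : D ≤ ℓ * D := le_mul_of_one_le_left (by linarith) hℓ1
    rw [hK, h1]
    linarith
  have hL : Real.log (2 / δ) ≤ 2 * D := by
    have h1 : Real.log (2 / δ) = Real.log 2 + Real.log (1 / δ) := by
      rw [← Real.log_mul (by norm_num) (by positivity), mul_one_div]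
    have := Real.log_two_lt_d9
    rw [h1]
    linarith
  have hHℓ : H ≤ 23 * ℓ / g :=
    hHup.trans (div_le_div_of_nonneg_right (by linarith) hg.le)
  refine le_measure_sampleComplexity_le M π hπ hε hδ0 hδ1.le hγ0 hγ1 hH1 hHγ (E := E) (F := F)
    (θ := θ) (by rw [hEeq]; positivity) hF0.le hθ0 ?_ (by rw [hEeq, hFθ]; exact le_of_eq (by ring))
    ?_ s₁
  · intro k hk
    have := bonus_le_add (ε := ε) hm1 hδ0 hδ1.le hγ1 hH0 hX1.le hk
    calc _ ≤ 3 * _ := mul_le_mul_of_nonneg_left this (by norm_num)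
      _ = _ := by rw [hE, hF, hK]; ring
  · rw [← hgdef, ← hmdef, h2Fθ, ← hcast]
    exact error_terms_le hm1' hD1 hℓ1 hε hg hg1 hεγ.le hHℓ hK0.le hKup hL
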